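/- Let $G$ be a finite group. A *Schur ring* (S-ring) over $G$ is a $\mathbb Z$-submodule $\mathfrak A$ of the group ring $\mathbb ZG$ for which there is a partition $\mathcal S=\mathcal S(\mathfrak A)$ of $G$ into (nonempty) *basic sets* such that $\{1_G\}\in\mathcal S$; $X^{-1}\in\mathcal S$ for all $X\in\mathcal S$; $\mathfrak A$ is the $\mathbb Z$-span of the elements $\underline X=\sum_{x\in X}x$, $X\in\mathcal S$; and $\underline X\,\underline Y\in\mathfrak A$ for all $X,Y\in\mathcal S$. S-rings over $G$ are ordered by inclusion. The *trivial* S-ring $\mathcal T(G)$ has basic sets $\{1_G\}$ and, if $G\ne 1$, $G\setminus\{1_G\}$. For $m\ge 1$, $\mathcal T_m(G)$ denotes its $m$th tensor power, the S-ring over $G^m$ whose basic sets are the products $X_1\times\cdots\times X_m$ with all $X_i\in\mathcal S(\mathcal T(G))$, and $\mathfrak A_m(G)$ denotes the smallest S-ring over $G^m$ that contains both $\mathcal T_m(G)$ and $\underline{D}$, where $D=\{(g,\dots,g):g\in G\}$ is the diagonal of $G^m$. A *combinatorial isomorphism* from an S-ring $\mathfrak A$ over $G$ to an S-ring $\mathfrak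 A'$ over $G'$ is a bijection $f:G\to G'$ such that for each $X\in\mathcal S(\mathfrak A)$ there is $X'\in\mathcal S(\mathfrak A')$ such that $f$ is an isomorphism of the Cayley graphs $\mathrm{Cay}(G,X)\to\mathrm{Cay}(G',X')$, i.e. for all $x,y\in G$ one has $xy^{-1}\in X$ if and only if $f(x)f(y)^{-1}\in X'$. Let $\mathrm{Hol}_m(G)=G^m\rtimes\mathrm{Aut}(G)$ be the permutation group on $G^m$ consisting of all maps $(x_1,\dots,x_m)\mapsto(\sigma(x_1)g_1,\dots,\sigma(x_m)g_m)$ with $\sigma\in\mathrm{Aut}(G)$ and $g_1,\dots,g_m\in G$. Permutation groups $K\le\mathrm{Sym}(\Omega)$ and $K'\le\mathrm{Sym}(\Omega')$ are *permutation isomorphic* if there are a bijection $f:\Omega\to\Omega'$ and a group isomorphism $\psi:K\to K'$ with $f(k(x))=\psi(k)(f(x))$ for all $k\in K$, $x\in\Omega$. **Theorem 1.1.** For every integer $m\ge 3$ and any two finite groups $G$ and $G'$, the following statements are equivalent: 1. the groups $G$ and $G'$ are isomorphic; 2. the S-rings $\mathfrak A_m(G)$ and $\mathfrak A_m(G')$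 are combinatorially isomorphic; 3. the permutation groups $\mathrm{Hol}_m(G)$ and $\mathrm{Hol}_m(G')$ are permutation isomorphic. -/

import Mathlib

open scoped Classical in
/-- For a subset `X` of a finite group, the sum of the elements of `X` in the group ring `ℤG`. -/
noncomputable def setSum {G : Type*} [Finite G] (X : Set G) : MonoidAlgebra ℤ G :=
  ∑ x ∈ X.toFinite.toFinset, MonoidAlgebra.single x (1 : ℤ)

open scoped Classical in
theorem coeff_setSum {G : Type*} [Finite G] (X : Set G) (y : G) :
    (setSum X).coeff y = if y ∈ X then 1 else 0 := by
  simp [setSum, MonoidAlgebra.coeff_sum, Finsupp.finsetSum_apply, Finsupp.single_apply]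

/-- The structure constants of the group ring: the coefficient of `z` in the product of the
sums of `X` and `Y` is the number of representations `z = x * y` with `x ∈ X`, `y ∈ Y`. -/
theorem coeff_setSum_mul {G : Type*} [Group G] [Finite G] (X Y : Set G) (z : G) :
    (setSum X * setSum Y).coeff z = (Nat.card {x : G // x ∈ X ∧ x⁻¹ * z ∈ Y} : ℤ) := by
  classical
  have := Fintype.ofFinite G
  conv_lhs => rw [setSum, Finset.sum_mul, MonoidAlgebra.coeff_sum, Finsupp.finsetSum_apply]
  simp only [MonoidAlgebra.coeff_single_mul_apply, coeff_setSum, one_mul]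
  rw [Finset.sum_boole, Nat.card_eq_fintype_card, Fintype.card_subtype]
  congr 2
  ext x
  simp

/-- For a partition `S` of a finite group, the `ℤ`-span of the sums of the classes consists of
the elements whose coefficients are constant on every class. -/
theorem mem_span_setSum_iff {G : Type*} [Finite G] {S : Set (Set G)}
    (hS : Setoid.IsPartition S) (a : MonoidAlgebra ℤ G) :
    a ∈ Submodule.span ℤ (setSum '' S) ↔
      ∀ X ∈ S, ∀ x ∈ X, ∀ y ∈ X, a.coeff x = a.coeff y := by
  classical
  constructor
  · intro ha
    induction ha using Submodule.span_induction with
    | mem b hb =>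
      obtain ⟨Y, hY, rfl⟩ := hb
      intro X hX x hx y hy
      simp only [coeff_setSum]
      have key : ∀ u ∈ X, u ∈ Y → X = Y := fun u hu hv =>
        (hS.2 u).unique ⟨hX, hu⟩ ⟨hY, hv⟩
      by_cases h : X = Y
      · subst h; simp [hx, hy]
      · rw [if_neg fun h' => h (key x hx h'), if_neg fun h' => h (key y hy h')]
    | zero => intros; simp
    | add b c _ _ hb hc =>
      intro X hX x hx y hy
      simp [hb X hX x hx y hy, hc X hX x hx y hy]
    | smul n b _ hb =>
      intro X hX x hx y hy
      simp [hb X hX x hx y hy]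
  · intro ha
    have hne : ∀ X ∈ S, X.Nonempty := fun X hX => Setoid.nonempty_of_mem_partition hS hX
    have : a = ∑ X ∈ S.toFinite.toFinset,
        (if h : X.Nonempty then a.coeff h.some else 0) • setSum X := by
      ext x
      obtain ⟨X, ⟨hX, hx⟩, huniq⟩ := hS.2 x
      rw [MonoidAlgebra.coeff_sum, Finsupp.finsetSum_apply, Finset.sum_eq_single X]
      · rw [dif_pos (hne X hX), MonoidAlgebra.coeff_smul_apply, coeff_setSum, if_pos hx]
        simpa using ha X hX x hx _ (hne X hX).some_mem
      · intro Y hY hYX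
        rw [MonoidAlgebra.coeff_smul_apply, coeff_setSum, if_neg, smul_zero]
        intro hxY
        exact hYX (huniq Y ⟨by simpa using hY, hxY⟩)
      · intro h
        exact absurd (by simpa using hX) h
    rw [this]
    refine Submodule.sum_mem _ fun X hX => Submodule.smul_mem _ _ (Submodule.subset_span ?_)
    exact ⟨X, by simpa using hX, rfl⟩

/-- A Schur ring (S-ring) over a finite group `G`, given by its partition of `G` into basic
sets; as a submodule of `ℤG` it is `SchurRing.toSubmodule`, which determines the partition. -/
structure SchurRing (G : Type*) [Group G] [Finite G] where
  /-- the basic sets -/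
  basicSets : Set (Set G)
  isPartition : Setoid.IsPartition basicSets
  one_mem : {1} ∈ basicSets
  inv_mem : ∀ X ∈ basicSets, (Inv.inv ⁻¹' X : Set G) ∈ basicSets
  mul_mem : ∀ X ∈ basicSets, ∀ Y ∈ basicSets,
    setSum X * setSum Y ∈ Submodule.span ℤ (setSum '' basicSets)

namespace SchurRing

/-- The underlying `ℤ`-submodule of the group ring, spanned by the sums of the basic sets. -/
noncomputable def toSubmodule {G : Type*} [Group G] [Finite G] (A : SchurRing G) :
    Submodule ℤ (MonoidAlgebra ℤ G) :=
  Submodule.span ℤ (setSum '' A.basicSets)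

theorem mem_toSubmodule_iff {G : Type*} [Group G] [Finite G] (A : SchurRing G)
    (a : MonoidAlgebra ℤ G) :
    a ∈ A.toSubmodule ↔ ∀ X ∈ A.basicSets, ∀ x ∈ X, ∀ y ∈ X, a.coeff x = a.coeff y :=
  mem_span_setSum_iff A.isPartition a

/-- An S-ring is closed under the multiplication of the group ring. -/
theorem toSubmodule_mul_mem {G : Type*} [Group G] [Finite G] (A : SchurRing G)
    {a b : MonoidAlgebra ℤ G} (ha : a ∈ A.toSubmodule) (hb : b ∈ A.toSubmodule) :
    a * b ∈ A.toSubmodule := by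
  have h := Submodule.mul_mem_mul ha hb
  rw [toSubmodule, Submodule.span_mul_span] at h
  refine Submodule.span_le.2 ?_ h
  rintro _ ⟨_, ⟨X, hX, rfl⟩, _, ⟨Y, hY, rfl⟩, rfl⟩
  exact A.mul_mem X hX Y hY

/-- S-rings over `G` are ordered by inclusion of the underlying submodules of `ℤG`. -/
noncomputable instance {G : Type*} [Group G] [Finite G] : Preorder (SchurRing G) :=
  Preorder.lift toSubmodule

/-- The submodule spanned by an S-ring determines its basic sets. -/
theorem toSubmodule_injective {G : Type*} [Group G] [Finite G] :
    Function.Injective (toSubmodule : SchurRing G → Submodule ℤ (MonoidAlgebra ℤ G)) := by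
  classical
  have key : ∀ A B : SchurRing G, A.toSubmodule = B.toSubmodule →
      ∀ X ∈ A.basicSets, ∀ Y ∈ B.basicSets, ∀ x ∈ X, x ∈ Y → Y ⊆ X := by
    intro A B h X hX Y hY x hxX hxY y hy
    have hm : setSum X ∈ B.toSubmodule := h ▸ Submodule.subset_span ⟨X, hX, rfl⟩
    have := (B.mem_toSubmodule_iff _).1 hm Y hY x hxY y hy
    simp only [coeff_setSum, if_pos hxX] at this
    by_contra hyX
    simp [hyX] at this
  have sub : ∀ A B : SchurRing G, A.toSubmodule = B.toSubmodule →
      A.basicSets ⊆ B.basicSets := by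
    intro A B h X hX
    obtain ⟨x, hx⟩ := Setoid.nonempty_of_mem_partition A.isPartition hX
    obtain ⟨Y, ⟨hY, hxY⟩, -⟩ := B.isPartition.2 x
    have : X = Y := Set.Subset.antisymm (key B A h.symm Y hY X hX x hxY hx)
      (key A B h X hX Y hY x hx hxY)
    exact this ▸ hY
  intro A B h
  have := Set.Subset.antisymm (sub A B h) (sub B A h.symm)
  cases A; cases B; cases this; rfl

/-- The trivial S-ring: its basic sets are `{1}` and, unless it is empty, the complement. -/
def trivialSRing (G : Type*) [Group G] [Finite G] : SchurRing G where
  basicSets := {X | X.Nonempty ∧ (X = {1} ∨ X = {1}ᶜ)}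
  isPartition := by
    refine ⟨fun h => h.1.ne_empty rfl, fun a => ?_⟩
    by_cases ha : a = 1
    · subst ha
      refine ⟨{1}, ⟨⟨⟨1, rfl⟩, Or.inl rfl⟩, rfl⟩, ?_⟩
      rintro Y ⟨⟨-, rfl | rfl⟩, h⟩
      · rfl
      · exact absurd rfl h
    · refine ⟨{1}ᶜ, ⟨⟨⟨a, ha⟩, Or.inr rfl⟩, ha⟩, ?_⟩
      rintro Y ⟨⟨-, rfl | rfl⟩, h⟩
      · exact absurd h ha
      · rfl
  one_mem := ⟨⟨1, rfl⟩, Or.inl rfl⟩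
  inv_mem := by
    rintro X ⟨⟨x, hx⟩, rfl | rfl⟩
    · exact ⟨⟨1, by simp⟩, Or.inl (by ext; simp)⟩
    · exact ⟨⟨x⁻¹, by simpa using hx⟩, Or.inr (by ext; simp)⟩
  mul_mem := by
    classical
    set S : Set (Set G) := {X | X.Nonempty ∧ (X = {1} ∨ X = {1}ᶜ)} with hS
    have hone : setSum ({1} : Set G) = 1 := by
      ext x
      simp [coeff_setSum, MonoidAlgebra.one_def, Finsupp.single_apply, eq_comm]
    have hcompl : setSum ({1}ᶜ : Set G) = setSum Set.univ - 1 := by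
      ext x
      by_cases hx : x = 1 <;> simp [coeff_setSum, MonoidAlgebra.one_def, hx]
    have hsq : setSum (Set.univ : Set G) * setSum Set.univ =
        (Nat.card G : ℤ) • setSum Set.univ := by
      ext x
      rw [coeff_setSum_mul, MonoidAlgebra.coeff_smul_apply]
      simp [coeff_setSum, Nat.card_congr (Equiv.subtypeUnivEquiv (fun _ : G => True.intro))]
    have h1 : (1 : MonoidAlgebra ℤ G) ∈ Submodule.span ℤ (setSum '' S) :=
      Submodule.subset_span ⟨{1}, ⟨⟨1, rfl⟩, Or.inl rfl⟩, hone⟩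
    have hc : setSum ({1}ᶜ : Set G) ∈ Submodule.span ℤ (setSum '' S) := by
      by_cases hne : ({1}ᶜ : Set G).Nonempty
      · exact Submodule.subset_span ⟨_, ⟨hne, Or.inr rfl⟩, rfl⟩
      · rw [Set.not_nonempty_iff_eq_empty] at hne
        rw [hne]
        simp [setSum]
    have hu : setSum (Set.univ : Set G) ∈ Submodule.span ℤ (setSum '' S) := by
      have := Submodule.add_mem _ hc h1
      rwa [hcompl, sub_add_cancel] at this
    rintro X ⟨-, rfl | rfl⟩ Y ⟨-, rfl | rfl⟩
    · rw [hone, one_mul]; exact h1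
    · rw [hone, one_mul]; exact hc
    · rw [hone, mul_one]; exact hc
    · have : setSum ({1}ᶜ : Set G) * setSum ({1}ᶜ : Set G) =
          (Nat.card G : ℤ) • setSum Set.univ - setSum Set.univ - setSum Set.univ + 1 := by
        rw [hcompl, sub_mul, mul_sub, hsq]; simp only [one_mul, mul_one]; abel
      rw [this]
      exact Submodule.add_mem _ (Submodule.sub_mem _ (Submodule.sub_mem _
        (Submodule.smul_mem _ _ hu) hu) hu) h1

theorem isPartition_tensorPower {G : Type*} [Group G] [Finite G] (m : ℕ) (A : SchurRing G) :
    Setoid.IsPartition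
      {X : Set (Fin m → G) | ∃ Y : Fin m → Set G, (∀ i, Y i ∈ A.basicSets) ∧
        X = Set.univ.pi Y} := by
  constructor
  · rintro ⟨Y, hY, h⟩
    exact (Set.univ_pi_nonempty_iff.2 fun i =>
      Setoid.nonempty_of_mem_partition A.isPartition (hY i)).ne_empty h.symm
  · intro a
    choose Y hY hYu using fun i => A.isPartition.2 (a i)
    refine ⟨Set.univ.pi Y, ⟨⟨Y, fun i => (hY i).1, rfl⟩, fun i _ => (hY i).2⟩, ?_⟩
    rintro _ ⟨⟨Z, hZ, rfl⟩, ha⟩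
    congr 1
    ext1 i
    exact hYu i (Z i) ⟨hZ i, ha i trivial⟩

/-- The `m`-th tensor power of an S-ring over `G`, an S-ring over `G^m`: its basic sets are the
Cartesian products of `m` basic sets. -/
def tensorPower {G : Type*} [Group G] [Finite G] (m : ℕ) (A : SchurRing G) :
    SchurRing (Fin m → G) where
  basicSets := {X | ∃ Y : Fin m → Set G, (∀ i, Y i ∈ A.basicSets) ∧ X = Set.univ.pi Y}
  isPartition := isPartition_tensorPower m A
  one_mem := ⟨fun _ => {1}, fun _ => A.one_mem, by ext; simp [funext_iff]⟩
  inv_mem := by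
    rintro _ ⟨Y, hY, rfl⟩
    exact ⟨fun i => Inv.inv ⁻¹' Y i, fun i => A.inv_mem _ (hY i), by ext; simp⟩
  mul_mem := by
    rintro _ ⟨X, hX, rfl⟩ _ ⟨Y, hY, rfl⟩
    rw [mem_span_setSum_iff (isPartition_tensorPower m A)]
    have hcoeff : ∀ z : Fin m → G, (setSum (Set.univ.pi X) * setSum (Set.univ.pi Y)).coeff z =
        ∏ i, (setSum (X i) * setSum (Y i)).coeff (z i) := by
      intro z
      simp only [coeff_setSum_mul]
      rw [← Nat.cast_prod, ← Nat.card_pi]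
      congr 1
      refine Nat.card_congr
        { toFun := fun x i => ⟨x.1 i, x.2.1 i trivial, x.2.2 i trivial⟩
          invFun := fun x => ⟨fun i => (x i).1, fun i _ => (x i).2.1, fun i _ => (x i).2.2⟩
          left_inv := fun _ => rfl
          right_inv := fun _ => rfl }
    rintro _ ⟨Z, hZ, rfl⟩ x hx y hy
    rw [hcoeff, hcoeff]
    refine Finset.prod_congr rfl fun i _ => ?_
    exact (mem_span_setSum_iff A.isPartition _).1 (A.mul_mem _ (hX i) _ (hY i)) _ (hZ i) _
      (hx i trivial) _ (hy i trivial)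

/-- The equivalence relation whose classes are the basic sets. -/
def toSetoid {G : Type*} [Group G] [Finite G] (A : SchurRing G) : Setoid G :=
  Setoid.mkClasses A.basicSets A.isPartition.2

theorem toSetoid_iff {G : Type*} [Group G] [Finite G] (A : SchurRing G) (x y : G) :
    A.toSetoid x y ↔ ∃ X ∈ A.basicSets, x ∈ X ∧ y ∈ X := by
  constructor
  · intro h
    obtain ⟨X, ⟨hX, hx⟩, -⟩ := A.isPartition.2 x
    exact ⟨X, hX, hx, h X hX hx⟩
  · rintro ⟨X, hX, hx, hy⟩ Y hY hxY
    exact (A.isPartition.2 x).unique ⟨hX, hx⟩ ⟨hY, hxY⟩ ▸ hy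

theorem mem_toSubmodule_iff_toSetoid {G : Type*} [Group G] [Finite G] (A : SchurRing G)
    (a : MonoidAlgebra ℤ G) : a ∈ A.toSubmodule ↔ A.toSetoid ≤ Setoid.ker a.coeff := by
  rw [mem_toSubmodule_iff]
  constructor
  · intro h x y hxy
    obtain ⟨X, hX, hx, hy⟩ := (A.toSetoid_iff x y).1 hxy
    exact h X hX x hx y hy
  · intro h X hX x hx y hy
    exact h ((A.toSetoid_iff x y).2 ⟨X, hX, hx, hy⟩)

theorem mem_span_classes_iff {G : Type*} [Group G] [Finite G] (F : Set (SchurRing G))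
    (a : MonoidAlgebra ℤ G) :
    a ∈ Submodule.span ℤ (setSum '' (sSup (toSetoid '' F)).classes) ↔
      ∀ A ∈ F, a ∈ A.toSubmodule := by
  rw [mem_span_setSum_iff (Setoid.isPartition_classes _)]
  have : (∀ X ∈ (sSup (toSetoid '' F)).classes, ∀ x ∈ X, ∀ y ∈ X, a.coeff x = a.coeff y) ↔
      sSup (toSetoid '' F) ≤ Setoid.ker a.coeff := by
    constructor
    · intro h x y hxy
      exact h _ (Setoid.mem_classes _ y) x hxy y (Setoid.refl' (sSup (toSetoid '' F)) y)
    · rintro h _ ⟨z, rfl⟩ x hx y hy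
      exact h (Setoid.trans' _ hx (Setoid.symm' _ hy))
  rw [this, sSup_le_iff]
  simp only [Set.forall_mem_image, mem_toSubmodule_iff_toSetoid]

/-- The intersection of a set of S-rings over `G`; its partition is the finest one that is
coarser than the partitions of all members. -/
def inter {G : Type*} [Group G] [Finite G] (F : Set (SchurRing G)) : SchurRing G where
  basicSets := (sSup (toSetoid '' F)).classes
  isPartition := Setoid.isPartition_classes _
  one_mem := by
    let e : Setoid G := Setoid.ker (fun x : G => x = 1)
    have he : sSup (toSetoid '' F) ≤ e := by
      refine sSup_le ?_
      rintro _ ⟨A, -, rfl⟩ x y hxy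
      obtain ⟨X, hX, hx, hy⟩ := (A.toSetoid_iff x y).1 hxy
      have aux : ∀ u ∈ X, ∀ v ∈ X, u = 1 → v = 1 := by
        rintro u hu v hv rfl
        have := (A.isPartition.2 1).unique ⟨hX, hu⟩ ⟨A.one_mem, rfl⟩
        rw [this] at hv
        exact hv
      exact propext ⟨aux x hx y hy, aux y hy x hx⟩
    refine ⟨1, ?_⟩
    ext x
    constructor
    · rintro rfl
      exact Setoid.refl' (sSup (toSetoid '' F)) 1
    · intro h
      have h' : (x = 1) = ((1 : G) = 1) := he h
      exact h'.mpr rfl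
  inv_mem := by
    let r : Setoid G := sSup (toSetoid '' F)
    have hr : r ≤ r.comap (Inv.inv : G → G) := by
      refine sSup_le ?_
      rintro _ ⟨A, hA, rfl⟩ x y hxy
      obtain ⟨X, hX, hx, hy⟩ := (A.toSetoid_iff x y).1 hxy
      have h1 : A.toSetoid x⁻¹ y⁻¹ :=
        (A.toSetoid_iff _ _).2 ⟨_, A.inv_mem X hX, by simpa using hx, by simpa using hy⟩
      exact (le_sSup (Set.mem_image_of_mem _ hA) : A.toSetoid ≤ r) h1
    rintro _ ⟨y, rfl⟩
    refine ⟨y⁻¹, ?_⟩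
    ext x
    constructor
    · intro h
      have h' : r (x⁻¹)⁻¹ y⁻¹ := hr h
      rwa [inv_inv] at h'
    · intro h
      have h' : r x⁻¹ (y⁻¹)⁻¹ := hr h
      rwa [inv_inv] at h'
  mul_mem := by
    intro X hX Y hY
    have aux : ∀ Z ∈ (sSup (toSetoid '' F)).classes, ∀ A ∈ F, setSum Z ∈ A.toSubmodule :=
      fun Z hZ => (mem_span_classes_iff F _).1 (Submodule.subset_span ⟨Z, hZ, rfl⟩)
    exact (mem_span_classes_iff F _).2 fun A hA =>
      A.toSubmodule_mul_mem (aux X hX A hA) (aux Y hY A hA)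

theorem mem_inter_iff {G : Type*} [Group G] [Finite G] (F : Set (SchurRing G))
    (a : MonoidAlgebra ℤ G) : a ∈ (inter F).toSubmodule ↔ ∀ A ∈ F, a ∈ A.toSubmodule :=
  mem_span_classes_iff F a

/-- The extension of `A` by the sum of a set `X`: the smallest S-ring containing both. -/
def extension {G : Type*} [Group G] [Finite G] (A : SchurRing G) (X : Set G) : SchurRing G :=
  inter {B | A ≤ B ∧ setSum X ∈ B.toSubmodule}

theorem isLeast_extension {G : Type*} [Group G] [Finite G] (A : SchurRing G) (X : Set G) :
    IsLeast {B : SchurRing G | A ≤ B ∧ setSum X ∈ B.toSubmodule} (A.extension X) := by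
  refine ⟨⟨fun a ha => ?_, ?_⟩, fun B hB a ha => ?_⟩
  · exact (mem_inter_iff _ _).2 fun B hB => hB.1 ha
  · exact (mem_inter_iff _ _).2 fun B hB => hB.2
  · exact (mem_inter_iff _ _).1 ha B hB

/-- The S-ring over `G^m` that is the extension of the `m`-th tensor power of the trivial S-ring
over `G` by the sum of the diagonal of `G^m`. -/
def diagonalExtension (m : ℕ) (G : Type*) [Group G] [Finite G] : SchurRing (Fin m → G) :=
  ((trivialSRing G).tensorPower m).extension {x | ∃ g : G, x = fun _ => g}

/-- The Cayley graph of `G` with respect to `X`: there is an arc between `x` and `y` iff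
`x * y⁻¹ ∈ X`. -/
def cayleyGraph {G : Type*} [Group G] (X : Set G) : Digraph G where
  Adj x y := x * y⁻¹ ∈ X

/-- A bijection `f` is a combinatorial isomorphism from `A` to `A'` if for every basic set `X`
of `A` there is a basic set `X'` of `A'` such that `f` is an isomorphism of Cayley graphs. -/
def IsCombIso {G G' : Type*} [Group G] [Finite G] [Group G'] [Finite G'] (A : SchurRing G)
    (A' : SchurRing G') (f : G ≃ G') : Prop :=
  ∀ X ∈ A.basicSets, ∃ X' ∈ A'.basicSets, ∀ x y : G,
    (cayleyGraph X).Adj x y ↔ (cayleyGraph X').Adj (f x) (f y)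

/-- Two S-rings are combinatorially isomorphic. -/
def CombIsomorphic {G G' : Type*} [Group G] [Finite G] [Group G'] [Finite G'] (A : SchurRing G)
    (A' : SchurRing G') : Prop :=
  ∃ f : G ≃ G', IsCombIso A A' f

end SchurRing

/-- The permutation of `G^m` induced by an automorphism of `G` acting componentwise. -/
def autComponentwise {G : Type*} [Group G] (m : ℕ) (σ : MulAut G) : Equiv.Perm (Fin m → G) :=
  Equiv.piCongrRight fun _ => σ.toEquiv

/-- The permutation group `Hol_m(G) = G^m ⋊ Aut(G)` on `G^m`: all products of a right
multiplication `x ↦ x * g`, `g ∈ G^m`, and a componentwise acting automorphism of `G`. -/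
def holPow (m : ℕ) (G : Type*) [Group G] : Subgroup (Equiv.Perm (Fin m → G)) where
  carrier := {π | ∃ (g : Fin m → G) (σ : MulAut G), π = Equiv.mulRight g * autComponentwise m σ}
  one_mem' := ⟨1, 1, by ext; simp [autComponentwise]⟩
  mul_mem' := by
    rintro _ _ ⟨g, σ, rfl⟩ ⟨h, τ, rfl⟩
    refine ⟨fun i => σ (h i) * g i, σ * τ, ?_⟩
    ext x i
    simp [autComponentwise, mul_assoc]
  inv_mem' := by
    rintro _ ⟨g, σ, rfl⟩
    refine ⟨fun i => σ⁻¹ (g i)⁻¹, σ⁻¹, ?_⟩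
    rw [inv_eq_iff_mul_eq_one]
    ext x i
    simp [autComponentwise]

/-- Permutation isomorphism of permutation groups: a bijection of the underlying sets and a group
isomorphism which are compatible with the actions. -/
def PermIsomorphic {Ω Ω' : Type*} (K : Subgroup (Equiv.Perm Ω))
    (K' : Subgroup (Equiv.Perm Ω')) : Prop :=
  ∃ (f : Ω ≃ Ω') (ψ : K ≃* K'), ∀ (k : K) (x : Ω),
    f ((k : Equiv.Perm Ω) x) = (ψ k : Equiv.Perm Ω') (f x)

/-!
The implications from (1) to (2) to (3) are formal. Isomorphic groups have isomorphic S-rings by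
minimality. A combinatorial isomorphism conjugates the automorphism groups of the two S-rings, and
the automorphism group of `𝔄_m(G)` is `Hol_m(G)` for `m ≥ 2`: the S-ring of the `Aut(G)`-orbits on
`G^m` contains `𝔄_m(G)`, so that `Hol_m(G)` acts by automorphisms
(`SchurRing.preserves_of_mem_holPow`). Conversely, an automorphism fixing `1` preserves the
equality of single coordinates, so it acts on each coordinate separately; as it preserves the
cosets of the diagonal, it acts on all coordinates by the same automorphism of `G`
(`SchurRing.mem_holPow_of_preserves`).

To recover `G` from the permutation group `K = Hol_m(G)`, let `A` be the stabilizer of a point. The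
group `K` contains `m + 1 ≥ 3` commuting copies of `G`, namely the right multiplications in the
coordinates and the left multiplications by diagonal elements. They form a `Frame`: together with
`A` they generate `K`, the stabilizer `A` acts on all of them in the same way, and the elements
of `A` in their product are the diagonal ones. A permutation isomorphism gives two such frames over
the same pair `(K, A)`, for `G` and for `G'`, and `Frame.nonempty_mulEquiv` shows `G ≃* G'`.

This is a theorem of Krull–Schmidt type. Leaving out one copy from each frame gives two regular
subgroups, isomorphic to `G^m` and to `G'^m`, and indecomposable `A`-invariant direct factors of the
copies of `G` are exchanged one at a time against factors of the copies of `G'`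
(`Frame.Mixed.exchange`). The two regular subgroups are different, so the projections onto factors
have to be compared as self-maps of the homogeneous space `K ⧸ A`. They need not be homomorphisms,
only crossed ones, but they are block maps (`IsBlockMap`), and for these Fitting's lemma and the
locality of the "endomorphism ring" of an indecomposable factor survive
(`IsBlockMap.injOn_or_nilpotent`, `IsBlockMap.injOn_or_injOn`). For an indecomposable factor `P` of
`G` one so finds a factor of `G'` whose projection from `P` and back to `P` is bijective. The way
back may be taken through any difference of two of the copies of `G`. With at least three copies,
the pair can be chosen such that the image of `P` centralizes the copy that is responsible for the
twist; then the crossed homomorphism is a homomorphism and the exchanged factors are isomorphic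
(`Frame.Mixed.nonempty_mulEquiv`).

Instead of matching isomorphism types of factors, the induction records numbers of homomorphisms,
which are multiplicative on direct products: for every finite group `F` the numbers of homomorphisms
from `F` to `G^m` and to `G'^m` agree (`Frame.Mixed.prod_card_hom_eq`). Hence so do those to `G` and
to `G'`, and by a theorem of Lovász (`nonempty_mulEquiv_of_card_hom_eq`) this forces `G ≃* G'`.
-/

/-! ### Counting homomorphisms into finite groups -/

instance finite_monoidHom {F G : Type*} [Group F] [Group G] [Finite F] [Finite G] :
    Finite (F →* G) :=
  Finite.of_injective (fun f : F →* G => (f : F → G)) DFunLike.coe_injective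

/-- A homomorphism is the same as its kernel together with an embedding of the quotient. -/
noncomputable def monoidHomEquivSigma (F G : Type*) [Group F] [Group G] :
    (F →* G) ≃ Σ N : {N : Subgroup F // N.Normal},
      (letI := N.2; {f : F ⧸ N.1 →* G // Function.Injective f}) where
  toFun f := ⟨⟨f.ker, inferInstance⟩, ⟨QuotientGroup.kerLift f, QuotientGroup.kerLift_injective f⟩⟩
  invFun f := letI := f.1.2; f.2.1.comp (QuotientGroup.mk' f.1.1)
  left_inv f := by ext x; rfl
  right_inv := by
    rintro ⟨⟨N, hN⟩, ⟨f, hf⟩⟩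
    have hk : (f.comp (QuotientGroup.mk' N)).ker = N := by
      ext x
      rw [MonoidHom.mem_ker, MonoidHom.comp_apply, map_eq_one_iff f hf]
      simp
    have key : ∀ (M : Subgroup F) (hM : M.Normal) (g : F ⧸ M →* G) (hg : Function.Injective g),
        M = N → (∀ x : F, g (QuotientGroup.mk x) = f (QuotientGroup.mk x)) →
        (⟨⟨M, hM⟩, ⟨g, hg⟩⟩ : Σ N : {N : Subgroup F // N.Normal},
          (letI := N.2; {f : F ⧸ N.1 →* G // Function.Injective f})) = ⟨⟨N, hN⟩, ⟨f, hf⟩⟩ := by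
      rintro M hM g hg rfl h
      have : g = f := by
        ext x
        exact h x
      subst this
      rfl
    exact key _ _ _ _ hk fun x => rfl

universe u v

/-- If two finite groups receive the same number of homomorphisms from every finite group, then
they also receive the same number of embeddings. -/
theorem card_injective_hom_eq {G : Type u} {G' : Type v} [Group G] [Finite G] [Group G']
    [Finite G']
    (h : ∀ (F : Type u) [Group F] [Finite F], Nat.card (F →* G) = Nat.card (F →* G'))
    (n : ℕ) (F : Type u) [Group F] [Finite F] (hn : Nat.card F = n) :
    Nat.card {f : F →* G // Function.Injective f} =
      Nat.card {f : F →* G' // Function.Injective f} := by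
  classical
  induction n using Nat.strong_induction_on generalizing F with
  | _ n ih =>
    have := Fintype.ofFinite {N : Subgroup F // N.Normal}
    have hF := h F
    rw [Nat.card_congr (monoidHomEquivSigma F G), Nat.card_congr (monoidHomEquivSigma F G'),
      Nat.card_sigma, Nat.card_sigma] at hF
    let b : {N : Subgroup F // N.Normal} := ⟨⊥, inferInstance⟩
    rw [← Finset.add_sum_erase _ _ (Finset.mem_univ b),
      ← Finset.add_sum_erase _ _ (Finset.mem_univ b)] at hF
    have hrest : ∀ N ∈ Finset.univ.erase b,
        (letI := N.2; Nat.card {f : F ⧸ N.1 →* G // Function.Injective f}) =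
        (letI := N.2; Nat.card {f : F ⧸ N.1 →* G' // Function.Injective f}) := by
      intro N hN
      let := N.2
      have hne : N.1 ≠ ⊥ := fun h' => (Finset.ne_of_mem_erase hN) (Subtype.ext h')
      refine ih _ ?_ (F ⧸ N.1) rfl
      rw [← hn, Subgroup.card_eq_card_quotient_mul_card_subgroup N.1]
      have h1 : 1 < Nat.card N.1 := (Subgroup.one_lt_card_iff_ne_bot _).2 hne
      exact lt_mul_of_one_lt_right Nat.card_pos h1
    rw [Finset.sum_congr rfl hrest] at hF
    have hb := Nat.add_right_cancel hF
    have e : F ⧸ (⊥ : Subgroup F) ≃* F := QuotientGroup.quotientBot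
    have c1 : Nat.card {f : F →* G // Function.Injective f} =
        Nat.card {f : F ⧸ (⊥ : Subgroup F) →* G // Function.Injective f} :=
      Nat.card_congr
        { toFun := fun f => ⟨f.1.comp e.toMonoidHom, f.2.comp e.injective⟩
          invFun := fun f => ⟨f.1.comp e.symm.toMonoidHom, f.2.comp e.symm.injective⟩
          left_inv := fun f => by ext x; simp
          right_inv := fun f => by ext x; simp }
    have c2 : Nat.card {f : F →* G' // Function.Injective f} =
        Nat.card {f : F ⧸ (⊥ : Subgroup F) →* G' // Function.Injective f} :=
      Nat.card_congr
        { toFun := fun f => ⟨f.1.comp e.toMonoidHom, f.2.comp e.injective⟩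
          invFun := fun f => ⟨f.1.comp e.symm.toMonoidHom, f.2.comp e.symm.injective⟩
          left_inv := fun f => by ext x; simp
          right_inv := fun f => by ext x; simp }
    rw [c1, c2]
    exact hb

/-- Lovász: a finite group is determined by the numbers of homomorphisms into it. -/
theorem nonempty_mulEquiv_of_card_hom_eq {G : Type u} {G' : Type v} [Group G] [Finite G]
    [Group G'] [Finite G'] (hcard : Nat.card G = Nat.card G')
    (h : ∀ (F : Type u) [Group F] [Finite F], Nat.card (F →* G) = Nat.card (F →* G')) :
    Nonempty (G ≃* G') := by
  have hinj := card_injective_hom_eq h _ G rfl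
  have : Nonempty {f : G →* G // Function.Injective f} := ⟨⟨MonoidHom.id G, fun _ _ h => h⟩⟩
  have hpos : 0 < Nat.card {f : G →* G' // Function.Injective f} := hinj ▸ Nat.card_pos
  obtain ⟨f, hf⟩ := (Nat.card_pos_iff.1 hpos).1
  exact ⟨MulEquiv.ofBijective f ((Nat.bijective_iff_injective_and_card f).2 ⟨hf, hcard⟩)⟩

theorem card_hom_congr {F G H : Type*} [Group F] [Group G] [Group H] (e : G ≃* H) :
    Nat.card (F →* G) = Nat.card (F →* H) :=
  Nat.card_congr
    { toFun := fun f => e.toMonoidHom.comp f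
      invFun := fun f => e.symm.toMonoidHom.comp f
      left_inv := fun f => by ext x; simp
      right_inv := fun f => by ext x; simp }

/-- For normal subgroups `P` and `R` with trivial intersection, `P ⊔ R` is their direct
product. -/
theorem exists_prod_mulEquiv_sup {G : Type*} [Group G] (P R : Subgroup G) [P.Normal] [R.Normal]
    (hd : Disjoint P R) :
    ∃ e : P × R ≃* (P ⊔ R : Subgroup G), ∀ x, (e x : G) = x.1 * x.2 := by
  have hc : ∀ (p : P) (r : R), Commute (P.subtype p) (R.subtype r) := fun p r =>
    Subgroup.commute_of_normal_of_disjoint P R inferInstance inferInstance hd p r p.2 r.2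
  have hf : Function.Injective (P.subtype.noncommCoprod R.subtype hc) := by
    rw [injective_iff_map_eq_one]
    rintro ⟨p, r⟩ h
    have h' : (p : G) * (r : G) = 1 := h
    have hp : (p : G) = 1 := by
      refine Subgroup.disjoint_def.1 hd p.2 ?_
      rw [eq_inv_of_mul_eq_one_left h']
      exact R.inv_mem r.2
    have hr : (r : G) = 1 := by simpa [hp] using h'
    exact Prod.ext (Subtype.ext hp) (Subtype.ext hr)
  have hr : (P.subtype.noncommCoprod R.subtype hc).range = P ⊔ R := by
    rw [MonoidHom.noncommCoprod_range]; simp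
  exact ⟨(MonoidHom.ofInjective hf).trans (MulEquiv.subgroupCongr hr), fun x => rfl⟩

theorem card_hom_sup {F G : Type*} [Group F] [Group G] (P R : Subgroup G) [P.Normal] [R.Normal]
    (hd : Disjoint P R) :
    Nat.card (F →* (P ⊔ R : Subgroup G)) = Nat.card (F →* P) * Nat.card (F →* R) := by
  obtain ⟨e, -⟩ := exists_prod_mulEquiv_sup P R hd
  rw [← card_hom_congr e, ← Nat.card_prod]
  exact Nat.card_congr
    { toFun := fun g => ((MonoidHom.fst P R).comp g, (MonoidHom.snd P R).comp g)
      invFun := fun g => g.1.prod g.2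
      left_inv := fun g => by ext x <;> rfl
      right_inv := fun g => by rfl }

/-- The projection onto a normal subgroup `P` along a normal complement `R`. -/
theorem exists_proj_of_isCompl {G : Type*} [Group G] (P R : Subgroup G) [P.Normal] [R.Normal]
    (h : IsCompl P R) : ∃ pr : G →* G, (∀ g, pr g ∈ P) ∧ (∀ p ∈ P, pr p = p) ∧
      ∀ r ∈ R, pr r = 1 := by
  obtain ⟨e, he⟩ := exists_prod_mulEquiv_sup P R h.disjoint
  have htop : ∀ g, g ∈ P ⊔ R := fun g => h.sup_eq_top ▸ Subgroup.mem_top g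
  let i : G →* (P ⊔ R : Subgroup G) := (MonoidHom.id G).codRestrict (P ⊔ R) htop
  have hi : ∀ p r, e.symm (i (p.1 * r.1)) = (p, r) := fun p r => by
    rw [MulEquiv.symm_apply_eq]; exact Subtype.ext (he (p, r)).symm
  refine ⟨P.subtype.comp ((MonoidHom.fst P R).comp (e.symm.toMonoidHom.comp i)),
    fun g => Subtype.mem _, fun p hp => ?_, fun r hr => ?_⟩
  · have := hi ⟨p, hp⟩ 1
    simp only [OneMemClass.coe_one, mul_one] at this
    simp [this]
  · have := hi 1 ⟨r, hr⟩
    simp only [OneMemClass.coe_one, one_mul] at this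
    simp [this]

/-! ### Block maps and a Fitting lemma -/

/-- Let `A` be a subgroup of `K`. The subgroups of `K` above `A` correspond to the blocks through
the base point of the homogeneous space `K ⧸ A`. A map `f : K → K` is a block map if images and
preimages of blocks are blocks, and preimages of the cosets of a block are the cosets of its
preimage. -/
structure IsBlockMap {K : Type*} [Group K] (A : Subgroup K) (f : K → K) : Prop where
  map_one : f 1 ∈ A
  preimage : ∀ Y, A ≤ Y → ∃ Z, A ≤ Z ∧ ∀ x y, (f x)⁻¹ * f y ∈ Y ↔ x⁻¹ * y ∈ Z
  image : ∀ Y, A ≤ Y → ∃ Z, A ≤ Z ∧ ∀ z, z ∈ Z ↔ ∃ x ∈ Y, ∃ a ∈ A, z = f x * a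

namespace IsBlockMap

variable {K : Type*} [Group K] {A : Subgroup K} {f g h : K → K}

theorem id : IsBlockMap A (_root_.id : K → K) where
  map_one := A.one_mem
  preimage Y hY := ⟨Y, hY, fun _ _ => Iff.rfl⟩
  image Y hY := ⟨Y, hY, fun z => ⟨fun hz => ⟨z, hz, 1, A.one_mem, by simp⟩, by
    rintro ⟨x, hx, a, ha, rfl⟩
    exact Y.mul_mem hx (hY ha)⟩⟩

theorem apply_mul_mem (hf : IsBlockMap A f) (x : K) {a : K} (ha : a ∈ A) :
    (f x)⁻¹ * f (x * a) ∈ A := by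
  obtain ⟨Z, hZ, h⟩ := hf.preimage A le_rfl
  rw [h]
  simpa using hZ ha

theorem comp (hf : IsBlockMap A f) (hg : IsBlockMap A g) : IsBlockMap A (f ∘ g) where
  map_one := by
    have h := hf.apply_mul_mem 1 hg.map_one
    rw [one_mul] at h
    simpa using A.mul_mem hf.map_one h
  preimage Y hY := by
    obtain ⟨Z, hZ, h⟩ := hf.preimage Y hY
    obtain ⟨W, hW, h'⟩ := hg.preimage Z hZ
    exact ⟨W, hW, fun x y => (h _ _).trans (h' _ _)⟩
  image Y hY := by
    obtain ⟨Z, hZ, h⟩ := hg.image Y hY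
    obtain ⟨W, hW, h'⟩ := hf.image Z hZ
    refine ⟨W, hW, fun z => (h' z).trans ⟨?_, ?_⟩⟩
    · rintro ⟨y, hy, a, ha, rfl⟩
      obtain ⟨x, hx, b, hb, rfl⟩ := (h y).1 hy
      exact ⟨x, hx, _, A.mul_mem (hf.apply_mul_mem (g x) hb) ha, by simp [mul_assoc]⟩
    · rintro ⟨x, hx, a, ha, rfl⟩
      exact ⟨g x, (h _).2 ⟨x, hx, 1, A.one_mem, by simp⟩, a, ha, rfl⟩

theorem iterate (hf : IsBlockMap A f) (n : ℕ) : IsBlockMap A f^[n] := by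
  induction n with
  | zero => exact IsBlockMap.id
  | succ n ih => exact ih.comp hf

/-- An `A`-equivariant map `f` on `K ⧸ A` is a block map as soon as it is a homomorphism on a
subgroup `N` that is transitive on `K ⧸ A`. -/
theorem of_supplement (N : Subgroup K) (hN : ∀ x, ∃ a ∈ A, x * a ∈ N)
    (hr : ∀ x, ∀ a ∈ A, f (x * a) = f x)
    (hmul : ∀ n ∈ N, ∀ k ∈ N, f (n * k) = f n * f k)
    (hl : ∀ a ∈ A, ∀ x, f (a * x) = a * f x * a⁻¹) : IsBlockMap A f := by
  have h1 : f 1 = 1 := by simpa using hmul 1 N.one_mem 1 N.one_mem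
  have hinv : ∀ n ∈ N, f n⁻¹ = (f n)⁻¹ := fun n hn => by
    rw [eq_inv_iff_mul_eq_one, ← hmul _ (N.inv_mem hn) _ hn, inv_mul_cancel, h1]
  have key : ∀ x y, ∃ a ∈ A, f (x⁻¹ * y) = a * ((f x)⁻¹ * f y) * a⁻¹ := by
    intro x y
    obtain ⟨a, ha, hx⟩ := hN x
    obtain ⟨b, hb, hy⟩ := hN y
    refine ⟨a, ha, ?_⟩
    have : x⁻¹ * y = a * ((x * a)⁻¹ * (y * b)) * b⁻¹ := by group
    rw [this, hr _ _ (A.inv_mem hb), hl _ ha, hmul _ (N.inv_mem hx) _ hy, hinv _ hx, hr _ _ ha,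
      hr _ _ hb]
  refine ⟨by rw [h1]; exact A.one_mem, fun Y hY => ?_, fun Y hY => ?_⟩
  · have key' : ∀ x y, (f x)⁻¹ * f y ∈ Y ↔ f (x⁻¹ * y) ∈ Y := by
      intro x y
      obtain ⟨a, ha, h⟩ := key x y
      rw [h, Y.mul_mem_cancel_right (Y.inv_mem (hY ha)), Y.mul_mem_cancel_left (hY ha)]
    refine ⟨{ carrier := {x | f x ∈ Y}, one_mem' := ?_, mul_mem' := ?_, inv_mem' := ?_ }, ?_,
      fun x y => key' x y⟩
    · intro x y hx hy
      have h := (key' x⁻¹ y).1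
      have hx' : f x⁻¹ ∈ Y := by
        have := (key' x 1).1 (by simpa [h1] using hx)
        simpa using this
      simpa using h (Y.mul_mem (Y.inv_mem hx') hy)
    · show f 1 ∈ Y
      rw [h1]
      exact Y.one_mem
    · intro x hx
      have := (key' x 1).1 (by simpa [h1] using hx)
      simpa using this
    · intro a ha
      have := hr 1 a ha
      rw [one_mul, h1] at this
      show f a ∈ Y
      rw [this]
      exact Y.one_mem
  · have hrep : ∀ z, (∃ x ∈ Y, ∃ a ∈ A, z = f x * a) ↔
        ∃ x ∈ Y, x ∈ N ∧ ∃ a ∈ A, z = f x * a := by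
      intro z
      refine ⟨?_, fun ⟨x, hx, _, h⟩ => ⟨x, hx, h⟩⟩
      rintro ⟨x, hx, a, ha, rfl⟩
      obtain ⟨b, hb, hxb⟩ := hN x
      exact ⟨x * b, Y.mul_mem hx (hY hb), hxb, a, ha, by rw [hr _ _ hb]⟩
    refine ⟨{ carrier := {z | ∃ x ∈ Y, ∃ a ∈ A, z = f x * a},
              one_mem' := ⟨1, Y.one_mem, 1, A.one_mem, by simp [h1]⟩,
              mul_mem' := ?_, inv_mem' := ?_ }, ?_, fun z => Iff.rfl⟩
    · rintro z w hz hw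
      obtain ⟨x, hx, hxN, a, ha, rfl⟩ := (hrep z).1 hz
      obtain ⟨y, hy, b, hb, rfl⟩ := hw
      obtain ⟨c, hc, hyN⟩ := hN (a * y)
      refine ⟨x * (a * y * c), Y.mul_mem hx (Y.mul_mem (Y.mul_mem (hY ha) hy) (hY hc)), a * b,
        A.mul_mem ha hb, ?_⟩
      rw [hmul _ hxN _ hyN, hr _ _ hc, hl _ ha]
      group
    · rintro z hz
      obtain ⟨x, hx, hxN, a, ha, rfl⟩ := (hrep z).1 hz
      refine ⟨a⁻¹ * x⁻¹, Y.mul_mem (hY (A.inv_mem ha)) (Y.inv_mem hx), a⁻¹, A.inv_mem ha, ?_⟩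
      rw [hl _ (A.inv_mem ha), hinv _ hxN]
      group
    · intro a ha
      exact ⟨1, Y.one_mem, a, ha, by simp [h1]⟩

/-- A block map into a subgroup that meets `A` trivially is injective once its kernel is
trivial. -/
theorem injOn {X : Subgroup K} (hf : IsBlockMap A f) (hXA : X ⊓ A = ⊥) (hfX : ∀ x, f x ∈ X)
    (hk : ∀ x ∈ X, f x = 1 → x = 1) : Set.InjOn f X := by
  intro x hx y hy hxy
  obtain ⟨Z, hZ, h⟩ := hf.preimage A le_rfl
  have hz : x⁻¹ * y ∈ Z := (h x y).1 (by simp [hxy])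
  have h1 : f 1 = 1 := by
    have : f 1 ∈ X ⊓ A := ⟨hfX 1, hf.map_one⟩
    rwa [hXA] at this
  have h2 : f (x⁻¹ * y) ∈ X ⊓ A :=
    ⟨hfX _, by simpa [h1] using (h 1 (x⁻¹ * y)).2 (by simpa using hz)⟩
  rw [hXA] at h2
  have := hk _ (X.mul_mem (X.inv_mem hx) hy) h2
  exact inv_mul_eq_one.1 this

end IsBlockMap

/-- Some positive iterate of a self-map of a finite type is idempotent. -/
theorem exists_iterate_idempotent {α : Type*} [Finite α] (f : α → α) :
    ∃ n, ∀ x, f^[n + 1] (f^[n + 1] x) = f^[n + 1] x := by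
  obtain ⟨a, b, hab, h⟩ := Finite.exists_ne_map_eq_of_infinite (fun n : ℕ => f^[n])
  wlog hlt : a < b generalizing a b
  · exact this b a hab.symm h.symm (by omega)
  obtain ⟨d, rfl⟩ : ∃ d, b = a + (d + 1) := ⟨b - a - 1, by omega⟩
  have h0 : ∀ x, f^[d + 1] (f^[a] x) = f^[a] x := fun x => by
    rw [← Function.iterate_add_apply, add_comm]
    exact (congrFun h x).symm
  -- `f^[d + 1]` fixes the range of `f^[a]`, hence so does every iterate of it.
  have h1 : ∀ k x, (f^[d + 1])^[k] (f^[a] x) = f^[a] x := fun k x =>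
    Function.iterate_fixed (h0 x) k
  refine ⟨(d + 1) * (a + 1) - 1, fun x => ?_⟩
  have he : (d + 1) * (a + 1) - 1 + 1 = (d + 1) * (a + 1) :=
    Nat.sub_add_cancel (Nat.mul_pos (by omega) (by omega))
  rw [he]
  have hle : a ≤ (d + 1) * (a + 1) := by nlinarith
  obtain ⟨c, hc⟩ := Nat.exists_eq_add_of_le hle
  have : f^[(d + 1) * (a + 1)] x = f^[a] (f^[c] x) := by
    rw [hc, Function.iterate_add_apply]
  rw [this, Function.iterate_mul, h1]

/-- A subgroup `X` is `A`-indecomposable if it is not the product of two nontrivial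
`A`-invariant subgroups that intersect trivially. -/
def IsIndecomposable {K : Type*} [Group K] (A X : Subgroup K) : Prop :=
  ∀ B C : Subgroup K, B ≤ X → C ≤ X → (∀ a ∈ A, ∀ b ∈ B, a * b * a⁻¹ ∈ B) →
    (∀ a ∈ A, ∀ c ∈ C, a * c * a⁻¹ ∈ C) → B ⊓ C = ⊥ →
    (∀ x ∈ X, ∃ b ∈ B, ∃ c ∈ C, x = b * c) → B = ⊥ ∨ C = ⊥

section Fitting

variable {K : Type*} [Group K] [Finite K] {A X : Subgroup K} {f g h : K → K}

/-- Fitting's lemma: a block map from an indecomposable subgroup to itself is injective or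
nilpotent. -/
theorem IsBlockMap.injOn_or_nilpotent (hXA : X ⊓ A = ⊥)
    (hX : ∀ a ∈ A, ∀ x ∈ X, a * x * a⁻¹ ∈ X) (hind : IsIndecomposable A X)
    (hf : IsBlockMap A f) (hfX : ∀ x, f x ∈ X) :
    Set.InjOn f X ∨ ∃ n, ∀ x ∈ X, f^[n] x = 1 := by
  obtain ⟨n, hn⟩ := exists_iterate_idempotent f
  set e := f^[n + 1] with he
  have heb : IsBlockMap A e := hf.iterate _
  have heX : ∀ x, e x ∈ X := fun x => by
    rw [he, Function.iterate_succ_apply']; exact hfX _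
  obtain ⟨Z, hZ, hpre⟩ := heb.preimage A le_rfl
  obtain ⟨Y, hY, him⟩ := heb.image ⊤ le_top
  have h1 : e 1 = 1 := by
    have : e 1 ∈ X ⊓ A := ⟨heX 1, heb.map_one⟩
    rwa [hXA] at this
  have hZ1 : ∀ x, x ∈ Z ↔ e x = 1 := by
    intro x
    have := hpre 1 x
    simp only [h1, inv_one, one_mul] at this
    rw [← this]
    refine ⟨fun hx => ?_, fun hx => hx ▸ A.one_mem⟩
    have : e x ∈ X ⊓ A := ⟨heX x, hx⟩
    rwa [hXA] at this
  have hY1 : ∀ x ∈ X, x ∈ Y → e x = x := by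
    intro x hx hxY
    obtain ⟨y, -, a, ha, rfl⟩ := (him x).1 hxY
    have : a ∈ X ⊓ A := ⟨(X.mul_mem_cancel_left (heX y)).1 hx, ha⟩
    rw [hXA, Subgroup.mem_bot] at this
    rw [this, mul_one]
    exact hn y
  have hdec := hind (Y ⊓ X) (Z ⊓ X) inf_le_right inf_le_right
    (fun a ha b hb => ⟨Y.mul_mem (Y.mul_mem (hY ha) hb.1) (Y.inv_mem (hY ha)), hX a ha b hb.2⟩)
    (fun a ha b hb => ⟨Z.mul_mem (Z.mul_mem (hZ ha) hb.1) (Z.inv_mem (hZ ha)), hX a ha b hb.2⟩)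
    (by
      rw [eq_bot_iff]
      rintro x ⟨⟨hxY, hx⟩, hxZ, -⟩
      rw [Subgroup.mem_bot, ← hY1 x hx hxY]
      exact (hZ1 x).1 hxZ)
    (fun x hx => ⟨e x, ⟨(him _).2 ⟨x, trivial, 1, A.one_mem, by simp⟩, heX x⟩, (e x)⁻¹ * x,
      ⟨(hpre _ _).1 (by simp [hn x]), X.mul_mem (X.inv_mem (heX x)) hx⟩, by simp⟩)
  rcases hdec with hB | hC
  · refine Or.inr ⟨n + 1, fun x hx => ?_⟩
    have : e x ∈ Y ⊓ X := ⟨(him _).2 ⟨x, trivial, 1, A.one_mem, by simp⟩, heX x⟩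
    rwa [hB] at this
  · refine Or.inl (hf.injOn hXA hfX fun x hx hfx => ?_)
    have hf1 : f 1 = 1 := by
      have : f 1 ∈ X ⊓ A := ⟨hfX 1, hf.map_one⟩
      rwa [hXA] at this
    have : x ∈ Z ⊓ X := by
      refine ⟨(hZ1 x).2 ?_, hx⟩
      rw [he, Function.iterate_succ_apply, hfx]
      exact Function.iterate_fixed hf1 n
    rwa [hC] at this

/-- A self-map that is injective on a finite set has an iterate as inverse there. -/
theorem exists_iterate_leftInverse (hfX : ∀ x, f x ∈ X) (hf : Set.InjOn f X) :
    ∃ n, ∀ x ∈ X, f^[n] (f x) = x := by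
  obtain ⟨n, hn⟩ := exists_iterate_idempotent f
  refine ⟨n, fun x hx => ?_⟩
  have hmaps : Set.MapsTo f X X := fun x _ => hfX x
  exact (hf.iterate hmaps (n + 1)) (hmaps.iterate (n + 1) hx) hx (hn x)

/-- The non-injective block maps into an indecomposable subgroup are closed under a weak form of
addition: `h` is thought of as the sum of `f` and `g`. -/
theorem IsBlockMap.injOn_or_injOn (hXA : X ⊓ A = ⊥)
    (hX : ∀ a ∈ A, ∀ x ∈ X, a * x * a⁻¹ ∈ X) (hind : IsIndecomposable A X)
    (hf : IsBlockMap A f) (hfX : ∀ x, f x ∈ X) (hg : IsBlockMap A g) (hgX : ∀ x, g x ∈ X)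
    (hh : IsBlockMap A h) (hhX : ∀ x, h x ∈ X) (hinj : Set.InjOn h X)
    (hsum : ∀ x ∈ X, f x = 1 → h x = g x) : Set.InjOn f X ∨ Set.InjOn g X := by
  obtain ⟨n, hn⟩ := exists_iterate_leftInverse hhX hinj
  have hmaps : ∀ x ∈ X, h^[n] x ∈ X :=
    fun x hx => (show Set.MapsTo h X X from fun x _ => hhX x).iterate n hx
  rcases ((hh.iterate n).comp hg).injOn_or_nilpotent hXA hX hind (fun x => hmaps _ (hgX x)) with
    hi | ⟨r, hr⟩
  · exact Or.inr fun x hx y hy hxy => hi hx hy (congrArg h^[n] hxy)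
  · refine Or.inl (hf.injOn hXA hfX fun x hx hfx => ?_)
    have hfix : (h^[n] ∘ g) x = x := by
      rw [Function.comp_apply, ← hsum x hx hfx, hn x hx]
    rw [← hr x hx]
    exact (Function.iterate_fixed hfix r).symm

end Fitting

/-! ### Frames -/

/-- A frame on a group `K` with point stabilizer `A`: commuting copies of `G` in `K`, indexed by
`I` and packed into one homomorphism from `I → G`, such that any `|I| - 1` of them generate a
regular normal subgroup of `K`, while the diagonal lies in `A`; moreover `A` acts on all copies in
the same way. -/
structure Frame {K : Type*} [Group K] (A : Subgroup K) (I G : Type*) [Group G] where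
  /-- the product of the embeddings of the copies of `G` -/
  hom : (I → G) →* K
  /-- the action of `A` on each of the copies -/
  act : A → G →* G
  conj : ∀ (a : A) (v : I → G), a * hom v * (a : K)⁻¹ = hom fun l => act a (v l)
  hom_mem_iff : ∀ v, hom v ∈ A ↔ ∀ l k, v l = v k
  exists_eq : ∀ x, ∃ v, ∃ a ∈ A, x = hom v * a

namespace Frame

variable {K : Type*} [Group K] {A : Subgroup K} {I G : Type*} [Group G] (𝓕 : Frame A I G)

/-- A subgroup of `G` is invariant if it is stable under the action of `A`. -/
def Inv (S : Subgroup G) : Prop := ∀ a, ∀ u ∈ S, 𝓕.act a u ∈ S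

theorem inv_bot : 𝓕.Inv ⊥ := by
  rintro a u hu
  rw [Subgroup.mem_bot] at hu
  simp [hu]

theorem inv_top : 𝓕.Inv ⊤ := fun _ _ _ => Subgroup.mem_top _

/-- Conjugation by any element of `K` preserves each copy of `G`, and each invariant subgroup
of it. -/
theorem exists_conj (x : K) : ∃ τ : I → G →* G,
    (∀ v, x * 𝓕.hom v * x⁻¹ = 𝓕.hom fun l => τ l (v l)) ∧
      ∀ S, 𝓕.Inv S → S.Normal → ∀ l, ∀ u ∈ S, τ l u ∈ S := by
  obtain ⟨c, a, ha, rfl⟩ := 𝓕.exists_eq x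
  refine ⟨fun l => (MulAut.conj (c l)).toMonoidHom.comp (𝓕.act ⟨a, ha⟩), fun v => ?_,
    fun S hS hn l u hu => hn.conj_mem _ (hS _ u hu) _⟩
  have h := 𝓕.conj ⟨a, ha⟩ v
  have : 𝓕.hom c * a * 𝓕.hom v * (𝓕.hom c * a)⁻¹ =
      𝓕.hom c * (a * 𝓕.hom v * a⁻¹) * (𝓕.hom c)⁻¹ := by group
  rw [this]
  simp only at h
  rw [h, ← map_inv, ← map_mul, ← map_mul]
  congr 1

open scoped Classical in
/-- The copy of `G` with index `l`. -/
noncomputable def ι (l : I) : G →* K := 𝓕.hom.comp (MonoidHom.mulSingle (fun _ => G) l)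

open scoped Classical in
theorem ι_apply (l : I) (u : G) : 𝓕.ι l u = 𝓕.hom (Pi.mulSingle l u) := rfl

theorem ι_mem_iff [Nontrivial I] (l : I) (u : G) : 𝓕.ι l u ∈ A ↔ u = 1 := by
  classical
  rw [ι_apply, hom_mem_iff]
  constructor
  · intro h
    obtain ⟨k, hk⟩ := exists_ne l
    simpa [hk] using h l k
  · rintro rfl
    simp

theorem ι_injective [Nontrivial I] (l : I) : Function.Injective (𝓕.ι l) := by
  rw [injective_iff_map_eq_one]
  intro u hu
  exact (𝓕.ι_mem_iff l u).1 (hu ▸ A.one_mem)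

theorem ι_conj (a : A) (l : I) (u : G) : a * 𝓕.ι l u * (a : K)⁻¹ = 𝓕.ι l (𝓕.act a u) := by
  classical
  rw [ι_apply, 𝓕.conj, ι_apply]
  congr 1
  ext k
  by_cases hk : k = l
  · subst hk; simp
  · simp [hk]

/-- The diagonal lies in `A` and induces the inner automorphisms of `G`. -/
theorem Inv.normal [Nontrivial I] {𝓕 : Frame A I G} {S : Subgroup G} (hS : 𝓕.Inv S) :
    S.Normal := by
  classical
  refine ⟨fun u hu g => ?_⟩
  have hg : 𝓕.hom (fun _ => g) ∈ A := (𝓕.hom_mem_iff _).2 fun _ _ => rfl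
  obtain ⟨l⟩ := (inferInstance : Nonempty I)
  have h := 𝓕.ι_conj ⟨_, hg⟩ l u
  have h' : 𝓕.hom (fun _ => g) * 𝓕.ι l u * (𝓕.hom fun _ => g)⁻¹ = 𝓕.ι l (g * u * g⁻¹) := by
    rw [ι_apply, ι_apply, ← map_inv, ← map_mul, ← map_mul]
    congr 1
    ext k
    by_cases hk : k = l
    · subst hk; simp
    · simp [hk]
  rw [𝓕.ι_injective l (h'.symm.trans h)]
  exact hS _ u hu

theorem Inv.sup [Nontrivial I] {𝓕 : Frame A I G} {S T : Subgroup G} (hS : 𝓕.Inv S)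
    (hT : 𝓕.Inv T) : 𝓕.Inv (S ⊔ T) := by
  intro a u hu
  have := hT.normal
  obtain ⟨s, hs, t, ht, rfl⟩ := Subgroup.mem_sup_of_normal_right.1 hu
  rw [map_mul]
  exact Subgroup.mul_mem_sup (hS a s hs) (hT a t ht)

theorem exists_ι_conj [Nontrivial I] (x : K) (l : I) : ∃ τ : G →* G,
    (∀ u, x * 𝓕.ι l u * x⁻¹ = 𝓕.ι l (τ u)) ∧ ∀ S, 𝓕.Inv S → ∀ u ∈ S, τ u ∈ S := by
  classical
  obtain ⟨τ, h, h'⟩ := 𝓕.exists_conj x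
  refine ⟨τ l, fun u => ?_, fun S hS => h' S hS hS.normal l⟩
  rw [ι_apply, h, ι_apply]
  congr 1
  ext k
  by_cases hk : k = l
  · subst hk; simp
  · simp [hk]

theorem normal_map_ι [Nontrivial I] {S : Subgroup G} (hS : 𝓕.Inv S) (l : I) :
    (S.map (𝓕.ι l)).Normal := by
  refine ⟨?_⟩
  rintro _ ⟨u, hu, rfl⟩ x
  obtain ⟨τ, h, h'⟩ := 𝓕.exists_ι_conj x l
  exact ⟨τ u, h' S hS u hu, (h u).symm⟩

theorem inv_of_map_ι [Nontrivial I] {S : Subgroup G} (l : I)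
    (hS : ∀ a ∈ A, ∀ x ∈ S.map (𝓕.ι l), a * x * a⁻¹ ∈ S.map (𝓕.ι l)) : 𝓕.Inv S := by
  intro a u hu
  have := hS a a.2 _ ⟨u, hu, rfl⟩
  rw [𝓕.ι_conj a l u] at this
  exact (Subgroup.mem_map_iff_mem (𝓕.ι_injective l)).1 this

/-- Every `A`-invariant subgroup of a copy of `G` comes from an invariant subgroup of `G`. -/
theorem exists_inv_map [Nontrivial I] {B : Subgroup K} (l : I) (hB : B ≤ (𝓕.ι l).range)
    (hA : ∀ a ∈ A, ∀ x ∈ B, a * x * a⁻¹ ∈ B) : ∃ S, 𝓕.Inv S ∧ S.map (𝓕.ι l) = B := by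
  have h : (B.comap (𝓕.ι l)).map (𝓕.ι l) = B := Subgroup.map_comap_eq_self hB
  exact ⟨B.comap (𝓕.ι l), 𝓕.inv_of_map_ι l (by rwa [h]), h⟩

/-- The coordinates of an element of `K`; they are determined up to right multiplication by a
diagonal element. -/
noncomputable def coord (x : K) : I → G := (𝓕.exists_eq x).choose

/-- The quotient of two coordinates of an element of `K`, which is well defined. -/
noncomputable def diff (p q : I) (x : K) : G := 𝓕.coord x p * (𝓕.coord x q)⁻¹

theorem diff_hom_mul (p q : I) (v : I → G) {a : K} (ha : a ∈ A) :
    𝓕.diff p q (𝓕.hom v * a) = v p * (v q)⁻¹ := by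
  obtain ⟨b, hb, h⟩ := (𝓕.exists_eq (𝓕.hom v * a)).choose_spec
  set w := (𝓕.exists_eq (𝓕.hom v * a)).choose with hw
  have h1 : 𝓕.hom (w⁻¹ * v) = b * a⁻¹ := by
    rw [map_mul, map_inv, eq_mul_inv_iff_mul_eq, mul_assoc, h]
    group
  have h2 := (𝓕.hom_mem_iff _).1 (h1 ▸ A.mul_mem hb (A.inv_mem ha)) p q
  simp only [Pi.mul_apply, Pi.inv_apply] at h2
  rw [diff, coord, ← hw]
  have h3 : v p = w p * ((w q)⁻¹ * v q) := by rw [← h2]; group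
  rw [h3]
  group

open scoped Classical in
theorem diff_ι (p q l : I) (u : G) : 𝓕.diff p q (𝓕.ι l u) =
    (Pi.mulSingle l u : I → G) p * ((Pi.mulSingle l u : I → G) q)⁻¹ := by
  rw [ι_apply]
  simpa using 𝓕.diff_hom_mul p q (Pi.mulSingle l u) A.one_mem

theorem diff_mul_diff (p q r : I) (x : K) :
    𝓕.diff p q x * 𝓕.diff q r x = 𝓕.diff p r x := by
  simp [diff, mul_assoc]

theorem diff_inv (p q : I) (x : K) : (𝓕.diff p q x)⁻¹ = 𝓕.diff q p x := by
  simp [diff]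

theorem diff_mul_right (p q : I) (x : K) {a : K} (ha : a ∈ A) :
    𝓕.diff p q (x * a) = 𝓕.diff p q x := by
  obtain ⟨v, b, hb, rfl⟩ := 𝓕.exists_eq x
  rw [mul_assoc, 𝓕.diff_hom_mul p q v (A.mul_mem hb ha), 𝓕.diff_hom_mul p q v hb]

theorem diff_mul_left (p q : I) (x : K) (a : A) :
    𝓕.diff p q (a * x) = 𝓕.act a (𝓕.diff p q x) := by
  obtain ⟨v, b, hb, rfl⟩ := 𝓕.exists_eq x
  have : (a : K) * (𝓕.hom v * b) = (a * 𝓕.hom v * (a : K)⁻¹) * (a * b) := by group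
  rw [this, 𝓕.conj, 𝓕.diff_hom_mul p q _ (A.mul_mem a.2 hb), 𝓕.diff_hom_mul p q v hb]
  simp

/-- The differences are crossed homomorphisms; the twist is the action on the copy `q`. -/
theorem exists_diff_mul [Nontrivial I] (p q : I) (x : K) : ∃ g : G, ∃ a : A,
    (∀ y, 𝓕.diff p q (x * y) = 𝓕.diff p q x * (g * 𝓕.act a (𝓕.diff p q y) * g⁻¹)) ∧
      ∀ u, x * 𝓕.ι q u * x⁻¹ = 𝓕.ι q (g * 𝓕.act a u * g⁻¹) := by
  classical
  obtain ⟨v, a, ha, rfl⟩ := 𝓕.exists_eq x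
  refine ⟨v q, ⟨a, ha⟩, fun y => ?_, fun u => ?_⟩
  · obtain ⟨w, b, hb, rfl⟩ := 𝓕.exists_eq y
    have h := 𝓕.conj ⟨a, ha⟩ w
    simp only at h
    have : 𝓕.hom v * a * (𝓕.hom w * b) =
        𝓕.hom (v * fun l => 𝓕.act ⟨a, ha⟩ (w l)) * (a * b) := by
      rw [map_mul, ← h]; group
    rw [this, 𝓕.diff_hom_mul p q _ (A.mul_mem ha hb), 𝓕.diff_hom_mul p q v ha,
      𝓕.diff_hom_mul p q w hb]
    simp [mul_assoc]
  · have h := 𝓕.ι_conj ⟨a, ha⟩ q u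
    simp only at h
    have : 𝓕.hom v * a * 𝓕.ι q u * (𝓕.hom v * a)⁻¹ =
        𝓕.hom v * (a * 𝓕.ι q u * a⁻¹) * (𝓕.hom v)⁻¹ := by group
    rw [this, h, ι_apply, ι_apply, ← map_inv, ← map_mul, ← map_mul]
    congr 1
    ext k
    by_cases hk : k = q
    · subst hk; simp
    · simp [hk]

theorem exists_mul_mem_hom (q : I) (x : K) : ∃ a ∈ A, ∃ v, v q = 1 ∧ x * a = 𝓕.hom v := by
  obtain ⟨v, a, ha, rfl⟩ := 𝓕.exists_eq x
  have hd : 𝓕.hom (fun _ => (v q)⁻¹) ∈ A := (𝓕.hom_mem_iff _).2 fun _ _ => rfl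
  refine ⟨a⁻¹ * 𝓕.hom (fun _ => (v q)⁻¹), A.mul_mem (A.inv_mem ha) hd,
    v * fun _ => (v q)⁻¹, by simp, ?_⟩
  rw [map_mul]
  group

/-- Projecting a difference of coordinates with an `A`-equivariant endomorphism `pr` of `G`, and
putting the result into a copy of `G`, gives a block map. -/
theorem isBlockMap_ι_diff (pr : G →* G) (hpr : ∀ a g, pr (𝓕.act a g) = 𝓕.act a (pr g))
    (j p q : I) : IsBlockMap A fun x => 𝓕.ι j (pr (𝓕.diff p q x)) := by
  -- On the regular subgroup of the elements `hom v` with `v q = 1` this is a homomorphism.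
  let N : Subgroup K := ((Pi.evalMonoidHom (fun _ : I => G) q).ker).map 𝓕.hom
  refine IsBlockMap.of_supplement N (fun x => ?_) (fun x a ha => ?_) ?_ (fun a ha x => ?_)
  · obtain ⟨a, ha, v, hv, h⟩ := 𝓕.exists_mul_mem_hom q x
    exact ⟨a, ha, v, hv, h.symm⟩
  · simp only [𝓕.diff_mul_right p q x ha]
  · rintro _ ⟨v, hv, rfl⟩ _ ⟨w, hw, rfl⟩
    have hv' : v q = 1 := hv
    have hw' : w q = 1 := hw
    have key : ∀ u : I → G, u q = 1 → 𝓕.diff p q (𝓕.hom u) = u p := fun u hu => by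
      have := 𝓕.diff_hom_mul p q u A.one_mem
      rw [mul_one] at this
      simp [this, hu]
    rw [key v hv', key w hw', ← map_mul 𝓕.hom, key _ (by simp [hv', hw'])]
    simp
  · have := 𝓕.diff_mul_left p q x ⟨a, ha⟩
    simp only at this
    simp only [this, hpr]
    exact (𝓕.ι_conj ⟨a, ha⟩ j _).symm

theorem proj_diff_mul_right [Nontrivial I] (pr : G →* G)
    (hpr : ∀ a g, pr (𝓕.act a g) = 𝓕.act a (pr g)) {p q : I} {h : K}
    (hh : pr (𝓕.diff p q h) = 1) (x : K) : pr (𝓕.diff p q (x * h)) = pr (𝓕.diff p q x) := by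
  obtain ⟨g, a, hg, -⟩ := 𝓕.exists_diff_mul p q x
  rw [hg, map_mul, map_mul, map_mul, hpr, hh]
  simp

end Frame

/-! ### Decompositions that mix two frames -/

/-- A regular normal subgroup of `K` that is the product of invariant subgroups `S' i` of the
copies of `G'` and of invariant subgroups `C l` of the copies of `G`. -/
structure Frame.Mixed {K : Type*} [Group K] {A : Subgroup K} {I G I' G' : Type*} [Group G]
    [Group G'] (𝓕 : Frame A I G) (𝓕' : Frame A I' G') (C : I → Subgroup G)
    (S' : I' → Subgroup G') : Prop where
  inv_left : ∀ l, 𝓕.Inv (C l)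
  inv_right : ∀ i, 𝓕'.Inv (S' i)
  exists_eq : ∀ x, ∃ v, (∀ i, v i ∈ S' i) ∧ ∃ c, (∀ l, c l ∈ C l) ∧ ∃ a ∈ A,
    x = 𝓕'.hom v * 𝓕.hom c * a
  eq_one : ∀ v c, (∀ i, v i ∈ S' i) → (∀ l, c l ∈ C l) → 𝓕'.hom v * 𝓕.hom c ∈ A →
    v = 1 ∧ c = 1

namespace Frame.Mixed

variable {K : Type*} [Group K] {A : Subgroup K} {I G I' G' : Type*} [Group G] [Group G']
  {𝓕 : Frame A I G} {𝓕' : Frame A I' G'} {C : I → Subgroup G}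
  {S' : I' → Subgroup G'} (M : 𝓕.Mixed 𝓕' C S')

include M

/-- The components of an element of `K` in the copies of `G'`. -/
noncomputable def coord (x : K) : I' → G' := (M.exists_eq x).choose

theorem coord_mem (x : K) (i : I') : M.coord x i ∈ S' i := (M.exists_eq x).choose_spec.1 i

open scoped Classical in
/-- The projection of `K` to the product of the factors `S' i` with `i ∈ J`. -/
noncomputable def proj (J : Finset I') (x : K) : K :=
  𝓕'.hom fun i => if i ∈ J then M.coord x i else 1

theorem proj_singleton (i : I') (x : K) : M.proj {i} x = 𝓕'.ι i (M.coord x i) := by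
  classical
  rw [proj, Frame.ι_apply]
  congr 1
  ext k
  by_cases hk : k = i
  · subst hk; simp
  · simp [hk]

theorem proj_insert [DecidableEq I'] {i : I'} {J : Finset I'} (hi : i ∉ J) (x : K) :
    M.proj (insert i J) x = M.proj J x * M.proj {i} x := by
  rw [proj, proj, proj, ← map_mul]
  congr 1
  ext k
  by_cases hk : k = i
  · subst hk; simp [hi]
  · simp [hk]

variable [Nontrivial I] [Nontrivial I']

theorem commute {v : I' → G'} {c : I → G} (hv : ∀ i, v i ∈ S' i) (hc : ∀ l, c l ∈ C l) :
    Commute (𝓕'.hom v) (𝓕.hom c) := by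
  obtain ⟨τ, hτ, hτS⟩ := 𝓕'.exists_conj (𝓕.hom c)
  obtain ⟨ρ, hρ, hρC⟩ := 𝓕.exists_conj (𝓕'.hom v)
  -- The commutator lies in both factors.
  have h1 := hτ v⁻¹
  have h2 := hρ c
  have h3 := M.eq_one (v * fun i => τ i (v⁻¹ i)) (fun l => ρ l (c l) * (c l)⁻¹)⁻¹
    (fun i => (S' i).mul_mem (hv i) (hτS _ (M.inv_right i) (M.inv_right i).normal i _
      ((S' i).inv_mem (hv i))))
    (fun l => (C l).inv_mem ((C l).mul_mem (hρC _ (M.inv_left l) (M.inv_left l).normal l _ (hc l))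
      ((C l).inv_mem (hc l))))
    (by
      have : (fun l => ρ l (c l) * (c l)⁻¹) = (fun l => ρ l (c l)) * c⁻¹ := rfl
      rw [this, map_inv, map_mul, map_mul, ← h1, ← h2, map_inv, map_inv]
      convert A.one_mem using 1
      group)
  have h4 : 𝓕'.hom (v * fun i => τ i (v⁻¹ i)) = 1 := by rw [h3.1, map_one]
  rw [map_mul, ← h1, map_inv] at h4
  rw [commute_iff_eq]
  have h5 : 𝓕'.hom v * (𝓕.hom c * (𝓕'.hom v)⁻¹ * (𝓕.hom c)⁻¹) * (𝓕.hom c * 𝓕'.hom v) =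
      𝓕'.hom v * 𝓕.hom c := by group
  rw [← h5, h4, one_mul]

theorem unique {v w : I' → G'} {c d : I → G} {a b : K} (hv : ∀ i, v i ∈ S' i)
    (hw : ∀ i, w i ∈ S' i) (hc : ∀ l, c l ∈ C l) (hd : ∀ l, d l ∈ C l) (ha : a ∈ A) (hb : b ∈ A)
    (h : 𝓕'.hom v * 𝓕.hom c * a = 𝓕'.hom w * 𝓕.hom d * b) : v = w := by
  have hwv : ∀ i, (w⁻¹ * v) i ∈ S' i := fun i => (S' i).mul_mem ((S' i).inv_mem (hw i)) (hv i)
  have hcd : ∀ l, (c * d⁻¹) l ∈ C l := fun l => (C l).mul_mem (hc l) ((C l).inv_mem (hd l))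
  have hd' : ∀ l, d⁻¹ l ∈ C l := fun l => (C l).inv_mem (hd l)
  have hdc : ∀ l, (d⁻¹ * c) l ∈ C l := fun l => (C l).mul_mem (hd' l) (hc l)
  have h1 : 𝓕'.hom (w⁻¹ * v) * 𝓕.hom (d⁻¹ * c) = b * a⁻¹ := by
    have e1 : 𝓕'.hom v = 𝓕'.hom w * 𝓕.hom d * b * a⁻¹ * (𝓕.hom c)⁻¹ := by
      rw [← h]; group
    rw [map_mul 𝓕.hom, ← mul_assoc, (M.commute hwv hd').eq, map_mul, map_inv, map_inv, e1]
    group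
  have h2 := (M.eq_one _ _ hwv hdc (h1 ▸ A.mul_mem hb (A.inv_mem ha))).1
  exact (inv_mul_eq_one.1 h2).symm

theorem coord_eq {v : I' → G'} {c : I → G} {a : K} (hv : ∀ i, v i ∈ S' i)
    (hc : ∀ l, c l ∈ C l) (ha : a ∈ A) : M.coord (𝓕'.hom v * 𝓕.hom c * a) = v := by
  obtain ⟨hw, d, hd, b, hb, h⟩ := (M.exists_eq (𝓕'.hom v * 𝓕.hom c * a)).choose_spec
  exact (M.unique hv hw hc hd ha hb h).symm

open scoped Classical in
theorem proj_eq (J : Finset I') {v : I' → G'} {c : I → G} {a : K} (hv : ∀ i, v i ∈ S' i)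
    (hc : ∀ l, c l ∈ C l) (ha : a ∈ A) :
    M.proj J (𝓕'.hom v * 𝓕.hom c * a) = 𝓕'.hom fun i => if i ∈ J then v i else 1 := by
  rw [proj, M.coord_eq hv hc ha]

theorem proj_mul_right (J : Finset I') (x : K) {a : K} (ha : a ∈ A) :
    M.proj J (x * a) = M.proj J x := by
  obtain ⟨v, hv, c, hc, b, hb, rfl⟩ := M.exists_eq x
  rw [mul_assoc, M.proj_eq J hv hc (A.mul_mem hb ha), M.proj_eq J hv hc hb]

theorem proj_one (J : Finset I') : M.proj J 1 = 1 := by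
  have := M.proj_eq J (v := 1) (c := 1) (fun i => (S' i).one_mem) (fun l => (C l).one_mem)
    A.one_mem
  simp only [map_one, mul_one, Pi.one_apply, ite_self] at this
  rw [this]
  exact map_one _

theorem isBlockMap_proj (J : Finset I') : IsBlockMap A (M.proj J) := by
  classical
  let N : Subgroup K :=
    { carrier := {x | ∃ v, (∀ i, v i ∈ S' i) ∧ ∃ c, (∀ l, c l ∈ C l) ∧ x = 𝓕'.hom v * 𝓕.hom c}
      one_mem' := ⟨1, fun i => (S' i).one_mem, 1, fun l => (C l).one_mem, by simp⟩
      mul_mem' := by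
        rintro _ _ ⟨v, hv, c, hc, rfl⟩ ⟨w, hw, d, hd, rfl⟩
        refine ⟨v * w, fun i => (S' i).mul_mem (hv i) (hw i), c * d,
          fun l => (C l).mul_mem (hc l) (hd l), ?_⟩
        rw [map_mul, map_mul, mul_assoc, mul_assoc, ← mul_assoc _ (𝓕'.hom w),
          ← (M.commute hw hc).eq, mul_assoc]
      inv_mem' := by
        rintro _ ⟨v, hv, c, hc, rfl⟩
        refine ⟨v⁻¹, fun i => (S' i).inv_mem (hv i), c⁻¹, fun l => (C l).inv_mem (hc l), ?_⟩
        rw [(M.commute hv hc).eq, mul_inv_rev, map_inv, map_inv] }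
  refine IsBlockMap.of_supplement N (fun x => ?_) (fun x a ha => M.proj_mul_right J x ha) ?_
    (fun a ha x => ?_)
  · obtain ⟨v, hv, c, hc, b, hb, rfl⟩ := M.exists_eq x
    exact ⟨b⁻¹, A.inv_mem hb, v, hv, c, hc, by simp⟩
  · rintro _ ⟨v, hv, c, hc, rfl⟩ _ ⟨w, hw, d, hd, rfl⟩
    have e : 𝓕'.hom v * 𝓕.hom c * (𝓕'.hom w * 𝓕.hom d) =
        𝓕'.hom (v * w) * 𝓕.hom (c * d) * 1 := by
      rw [map_mul, map_mul, mul_one, mul_assoc, mul_assoc, ← mul_assoc _ (𝓕'.hom w),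
          ← (M.commute hw hc).eq, mul_assoc]
    rw [e, M.proj_eq J (v := v * w) (c := c * d) (fun i => (S' i).mul_mem (hv i) (hw i))
      (fun l => (C l).mul_mem (hc l) (hd l)) A.one_mem, ← mul_one (𝓕'.hom v * 𝓕.hom c),
      ← mul_one (𝓕'.hom w * 𝓕.hom d), M.proj_eq J hv hc A.one_mem, M.proj_eq J hw hd A.one_mem,
      ← map_mul]
    congr 1
    ext k
    by_cases hk : k ∈ J <;> simp [hk]
  · obtain ⟨v, hv, c, hc, b, hb, rfl⟩ := M.exists_eq x
    have h1 := 𝓕'.conj ⟨a, ha⟩ v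
    have h2 := 𝓕.conj ⟨a, ha⟩ c
    have h3 := 𝓕'.conj ⟨a, ha⟩ fun i => if i ∈ J then v i else 1
    simp only at h1 h2 h3
    have e : a * (𝓕'.hom v * 𝓕.hom c * b) =
        (a * 𝓕'.hom v * a⁻¹) * (a * 𝓕.hom c * a⁻¹) * (a * b) := by group
    rw [e, h1, h2, M.proj_eq J (fun i => M.inv_right i _ _ (hv i))
      (fun l => M.inv_left l _ _ (hc l)) (A.mul_mem ha hb), M.proj_eq J hv hc hb, h3]
    congr 1
    ext k
    by_cases hk : k ∈ J <;> simp [hk]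

end Frame.Mixed

/-! ### Exchanging an indecomposable factor -/

/-- The data of an exchange step: an indecomposable direct factor `P` of `G`, with the projection
`pr` onto it, in a copy `j` of `G` in which the mixed decomposition only involves the kernel
of `pr`. -/
structure Frame.Factor {K : Type*} [Group K] {A : Subgroup K} {I G : Type*} [Group G]
    (𝓕 : Frame A I G) (C : I → Subgroup G) (o j : I) where
  /-- the direct factor -/
  P : Subgroup G
  /-- the projection onto the direct factor -/
  pr : G →* G
  inv : 𝓕.Inv P
  ne_bot : P ≠ ⊥
  ne : j ≠ o
  pr_act : ∀ a g, pr (𝓕.act a g) = 𝓕.act a (pr g)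
  pr_mem : ∀ g, pr g ∈ P
  pr_eq : ∀ g ∈ P, pr g = g
  pr_left : ∀ c ∈ C j, pr c = 1
  base : C o = ⊥
  indec : IsIndecomposable A (P.map (𝓕.ι j))

namespace Frame.Factor

variable {K : Type*} [Group K] {A : Subgroup K} {I G : Type*} [Group G] {𝓕 : Frame A I G}
  {C : I → Subgroup G} {o j : I} (D : 𝓕.Factor C o j)

/-- The copy of the direct factor `P` inside the copy `j` of `G`. -/
noncomputable def X : Subgroup K := D.P.map (𝓕.ι j)

/-- The block map that sends an element of `K` to the `P`-part of the quotient of its coordinates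
`p` and `q`. -/
noncomputable def quot (p q : I) (x : K) : K := 𝓕.ι j (D.pr (𝓕.diff p q x))

theorem isBlockMap_quot (p q : I) : IsBlockMap A (D.quot p q) :=
  𝓕.isBlockMap_ι_diff D.pr D.pr_act j p q

theorem quot_mem (p q : I) (x : K) : D.quot p q x ∈ D.X :=
  ⟨_, D.pr_mem _, rfl⟩

theorem quot_of_mem {x : K} (hx : x ∈ D.X) : D.quot j o x = x := by
  classical
  obtain ⟨u, hu, rfl⟩ := hx
  rw [Frame.Factor.quot, 𝓕.diff_ι]
  simp [D.ne.symm, D.pr_eq u hu]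

theorem quot_mul_quot (p q r : I) (x : K) :
    D.quot p q x * D.quot q r x = D.quot p r x := by
  rw [Frame.Factor.quot, Frame.Factor.quot, ← map_mul, ← map_mul, 𝓕.diff_mul_diff]
  rfl

theorem quot_inv (p q : I) (x : K) :
    (D.quot p q x)⁻¹ = D.quot q p x := by
  rw [Frame.Factor.quot, ← map_inv, ← map_inv, 𝓕.diff_inv]
  rfl

variable [Nontrivial I]

theorem X_inf : D.X ⊓ A = ⊥ := by
  rw [eq_bot_iff]
  rintro _ ⟨⟨u, -, rfl⟩, hA⟩
  rw [Subgroup.mem_bot, (𝓕.ι_mem_iff j u).1 hA, map_one]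

theorem X_conj (x : K) : ∀ y ∈ D.X, x * y * x⁻¹ ∈ D.X :=
  fun y hy => (𝓕.normal_map_ι D.inv j).conj_mem y hy x

theorem quot_eq_one_iff (p q : I) (x : K) :
    D.quot p q x = 1 ↔ D.pr (𝓕.diff p q x) = 1 :=
  map_eq_one_iff _ (𝓕.ι_injective j)

theorem quot_mul_right {p q : I} {h : K} (hh : D.quot p q h = 1) (x : K) :
    D.quot p q (x * h) = D.quot p q x := by
  rw [Frame.Factor.quot, 𝓕.proj_diff_mul_right D.pr D.pr_act ((D.quot_eq_one_iff p q h).1 hh)]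
  rfl

theorem quot_one (p q : I) : D.quot p q 1 = 1 := by
  rw [D.quot_eq_one_iff]
  have := 𝓕.diff_hom_mul p q 1 A.one_mem
  rw [map_one, mul_one] at this
  simp [this]

theorem quot_ι_of_ne {p q l : I} (hp : p ≠ l) (hq : q ≠ l) (u : G) :
    D.quot p q (𝓕.ι l u) = 1 := by
  classical
  rw [D.quot_eq_one_iff, 𝓕.diff_ι]
  simp [hp, hq]

end Frame.Factor

namespace Frame.Mixed

variable {K : Type*} [Group K] {A : Subgroup K} {I G I' G' : Type*} [Group G] [Group G']
  [Nontrivial I] [Nontrivial I'] {𝓕 : Frame A I G} {𝓕' : Frame A I' G'} {C : I → Subgroup G}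
  {S' : I' → Subgroup G'} (M : 𝓕.Mixed 𝓕' C S') {o j : I} (D : 𝓕.Factor C o j)

include M

theorem quot_proj_univ [Fintype I'] {x : K} (hx : x ∈ D.X) :
    D.quot j o (M.proj Finset.univ x) = x := by
  obtain ⟨v, hv, c, hc, a, ha, hxe⟩ := M.exists_eq x
  have h1 : M.proj Finset.univ x = x * (a⁻¹ * (𝓕.hom c)⁻¹) := by
    conv_lhs => rw [hxe, M.proj_eq _ hv hc ha]
    rw [hxe]
    simp
  have h2 : D.quot j o (a⁻¹ * (𝓕.hom c)⁻¹) = 1 := by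
    have h3 := 𝓕.diff_mul_left j o (𝓕.hom c)⁻¹ ⟨a⁻¹, A.inv_mem ha⟩
    have h4 := 𝓕.diff_hom_mul j o c⁻¹ A.one_mem
    rw [mul_one, map_inv] at h4
    have h5 : c o = 1 := by simpa [D.base] using hc o
    rw [D.quot_eq_one_iff]
    simp only at h3
    rw [h3, D.pr_act, h4]
    simp [h5, D.pr_left _ (hc j)]
  rw [h1, D.quot_mul_right h2, D.quot_of_mem hx]

/-- Some factor of the mixed decomposition contains an isomorphic image of `P`, seen from the
base copy `o`. -/
theorem exists_injOn [Finite K] [Finite I'] : ∃ i, Set.InjOn (D.quot j o ∘ M.proj {i}) D.X := by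
  classical
  have := Fintype.ofFinite I'
  have key : ∀ J : Finset I', Set.InjOn (D.quot j o ∘ M.proj J) D.X →
      ∃ i, Set.InjOn (D.quot j o ∘ M.proj {i}) D.X := by
    intro J
    induction J using Finset.induction_on with
    | empty =>
      intro h
      obtain ⟨⟨u, hu⟩, hu1⟩ := Subgroup.ne_bot_iff_exists_ne_one.1 D.ne_bot
      have h0 : ∀ x, M.proj ∅ x = 1 := fun x => by
        simp only [proj, Finset.notMem_empty, if_false]
        exact map_one _
      have h1 := h (show 𝓕.ι j u ∈ D.X from ⟨u, hu, rfl⟩) D.X.one_mem (by simp [h0])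
      exact absurd (Subtype.ext ((map_eq_one_iff _ (𝓕.ι_injective j)).1 h1)) hu1
    | insert i J hi ih =>
      intro h
      rcases IsBlockMap.injOn_or_injOn D.X_inf (fun a _ => D.X_conj a) D.indec
        ((D.isBlockMap_quot j o).comp (M.isBlockMap_proj {i})) (fun x => D.quot_mem _ _ _)
        ((D.isBlockMap_quot j o).comp (M.isBlockMap_proj J)) (fun x => D.quot_mem _ _ _)
        ((D.isBlockMap_quot j o).comp (M.isBlockMap_proj (insert i J)))
        (fun x => D.quot_mem _ _ _) h (fun x _ hfx => by
          rw [Function.comp_apply, M.proj_insert hi, D.quot_mul_right hfx]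
          rfl) with h' | h'
      · exact ⟨i, h'⟩
      · exact ih h'
  refine key Finset.univ fun x hx y hy hxy => ?_
  simpa [M.quot_proj_univ D hx, M.quot_proj_univ D hy] using hxy

/-- The image of `P` in the factor `i` is the image of an invariant subgroup of `G'`. -/
theorem exists_image (i : I') : ∃ Q : Subgroup G', 𝓕'.Inv Q ∧ Q ≤ S' i ∧
    ∀ z, z ∈ Q.map (𝓕'.ι i) ↔ ∃ x ∈ D.X, z = M.proj {i} x := by
  obtain ⟨Y, hY, hYim⟩ := (M.isBlockMap_proj {i}).image (D.X ⊔ A) le_sup_right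
  have hXn : D.X.Normal := 𝓕.normal_map_ι D.inv j
  have hmem : ∀ z, z ∈ Y ⊓ (S' i).map (𝓕'.ι i) ↔ ∃ x ∈ D.X, z = M.proj {i} x := by
    intro z
    constructor
    · rintro ⟨hz, w, hw, hwz⟩
      obtain ⟨x, hx, a, ha, rfl⟩ := (hYim z).1 hz
      obtain ⟨x, hx', b, hb, rfl⟩ := Subgroup.mem_sup_of_normal_left.1 hx
      refine ⟨x, hx', ?_⟩
      rw [M.proj_mul_right _ _ hb, M.proj_singleton] at hwz ⊢
      have h1 : 𝓕'.ι i ((M.coord x i)⁻¹ * w) = a := by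
        rw [map_mul, hwz, map_inv]; group
      have h2 := (𝓕'.ι_mem_iff i _).1 (h1 ▸ ha)
      rw [h2, map_one] at h1
      rw [← h1, mul_one]
    · rintro ⟨x, hx, rfl⟩
      refine ⟨(hYim _).2 ⟨x, Subgroup.mem_sup_left hx, 1, A.one_mem, by simp⟩, ?_⟩
      rw [M.proj_singleton]
      exact ⟨_, M.coord_mem x i, rfl⟩
  have hN : ((S' i).map (𝓕'.ι i)).Normal := 𝓕'.normal_map_ι (M.inv_right i) i
  obtain ⟨Q, hQ, hQm⟩ := 𝓕'.exists_inv_map (B := Y ⊓ (S' i).map (𝓕'.ι i)) i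
    (by
      rintro _ ⟨-, w, -, rfl⟩
      exact ⟨w, rfl⟩)
    (fun a ha x hx => ⟨Y.mul_mem (Y.mul_mem (hY ha) hx.1) (Y.inv_mem (hY ha)),
      hN.conj_mem _ hx.2 _⟩)
  refine ⟨Q, hQ, fun w hw => ?_, fun z => by rw [hQm, hmem]⟩
  have : 𝓕'.ι i w ∈ Y ⊓ (S' i).map (𝓕'.ι i) := hQm ▸ ⟨w, hw, rfl⟩
  exact (Subgroup.mem_map_iff_mem (𝓕'.ι_injective i)).1 this.2

/-- If the image of `P` in the factor `i` does not centralize the copy `l` of `P`, it meets this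
copy, and then it cannot be seen from two other copies. -/
theorem commute_of_injOn {i : I'} {Q : Subgroup G'} (hQ : 𝓕'.Inv Q)
    (hQm : ∀ z, z ∈ Q.map (𝓕'.ι i) ↔ ∃ x ∈ D.X, z = M.proj {i} x) {p q l : I} (hp : p ≠ l)
    (hq : q ≠ l) (hinj : Set.InjOn (D.quot p q ∘ M.proj {i}) D.X) :
    ∀ y ∈ Q.map (𝓕'.ι i), ∀ u ∈ D.P, Commute y (𝓕.ι l u) := by
  have h1 := 𝓕'.normal_map_ι hQ i
  have h2 := 𝓕.normal_map_ι D.inv l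
  intro y hy u hu
  refine Subgroup.commute_of_normal_of_disjoint _ _ h1 h2 ?_ y _ hy ⟨u, hu, rfl⟩
  rw [Subgroup.disjoint_def]
  rintro z hz ⟨w, hw, rfl⟩
  obtain ⟨x, hx, hzx⟩ := (hQm _).1 hz
  have h3 := hinj hx D.X.one_mem (by
    rw [Function.comp_apply, Function.comp_apply, ← hzx, D.quot_ι_of_ne hp hq, M.proj_one,
      D.quot_one])
  rw [hzx, h3, M.proj_one]

/-- With at least three copies of `G`, the image of `P` in the factor `i` is seen isomorphically
from two copies of `G`, one of which it centralizes. -/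
theorem exists_injOn_and_commute [Finite K] [Fintype I] (hI : 3 ≤ Fintype.card I) {i : I'}
    {Q : Subgroup G'} (hQ : 𝓕'.Inv Q)
    (hQm : ∀ z, z ∈ Q.map (𝓕'.ι i) ↔ ∃ x ∈ D.X, z = M.proj {i} x)
    (hinj : Set.InjOn (D.quot j o ∘ M.proj {i}) D.X) :
    ∃ p q, Set.InjOn (D.quot p q ∘ M.proj {i}) D.X ∧
      ∀ y ∈ Q.map (𝓕'.ι i), ∀ u ∈ D.P, Commute y (𝓕.ι q u) := by
  classical
  obtain ⟨r, hr⟩ : ∃ r, r ∉ ({j, o} : Finset I) := by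
    by_contra! h
    have h1 : (Finset.univ : Finset I) ⊆ {j, o} := fun x _ => h x
    have h2 := Finset.card_le_card h1
    have h3 : ({j, o} : Finset I).card ≤ 2 := Finset.card_le_two
    rw [Finset.card_univ] at h2
    omega
  have hrj : r ≠ j := fun h => hr (by simp [h])
  have hro : r ≠ o := fun h => hr (by simp [h])
  rcases IsBlockMap.injOn_or_injOn D.X_inf (fun a _ => D.X_conj a) D.indec
    ((D.isBlockMap_quot j r).comp (M.isBlockMap_proj {i})) (fun x => D.quot_mem _ _ _)
    ((D.isBlockMap_quot r o).comp (M.isBlockMap_proj {i})) (fun x => D.quot_mem _ _ _)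
    ((D.isBlockMap_quot j o).comp (M.isBlockMap_proj {i})) (fun x => D.quot_mem _ _ _) hinj
    (fun x _ hfx => by
      have h := D.quot_mul_quot j r o (M.proj {i} x)
      rw [Function.comp_apply] at hfx
      rw [Function.comp_apply, Function.comp_apply, ← h, hfx, one_mul]) with h | h
  · exact ⟨j, o, hinj, M.commute_of_injOn D hQ hQm D.ne hro h⟩
  · refine ⟨o, j, fun x hx y hy hxy => hinj hx hy ?_,
      M.commute_of_injOn D hQ hQm hrj D.ne.symm h⟩
    simp only [Function.comp_apply] at hxy ⊢
    rw [← D.quot_inv o j, ← D.quot_inv o j, hxy]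

/-- The image of `P` in the factor `i` is isomorphic to `P`. -/
theorem nonempty_mulEquiv [Finite K] [Fintype I] (hI : 3 ≤ Fintype.card I) {i : I'}
    {Q : Subgroup G'} (hQ : 𝓕'.Inv Q)
    (hQm : ∀ z, z ∈ Q.map (𝓕'.ι i) ↔ ∃ x ∈ D.X, z = M.proj {i} x)
    (hinj : Set.InjOn (D.quot j o ∘ M.proj {i}) D.X) : Nonempty (Q ≃* D.P) := by
  obtain ⟨p, q, hpq, hcomm⟩ := M.exists_injOn_and_commute D hI hQ hQm hinj
  -- Since the image centralizes the copy `q`, the crossed homomorphism is a homomorphism.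
  have hmul : ∀ y ∈ Q.map (𝓕'.ι i), ∀ z, D.pr (𝓕.diff p q (y * z)) =
      D.pr (𝓕.diff p q y) * D.pr (𝓕.diff p q z) := by
    intro y hy z
    obtain ⟨g, a, h1, h2⟩ := 𝓕.exists_diff_mul p q y
    have h3 : ∀ u ∈ D.P, g * 𝓕.act a u * g⁻¹ = u := fun u hu => by
      apply 𝓕.ι_injective q
      rw [← h2, (hcomm y hy u hu).eq, mul_inv_cancel_right]
    have h4 := congrArg D.pr (h3 _ (D.pr_mem (𝓕.diff p q z)))
    rw [h1, map_mul, map_mul, map_mul, D.pr_act]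
    rw [map_mul, map_mul, D.pr_act, D.pr_eq _ (D.pr_mem _)] at h4
    rw [h4]
  let f : Q →* D.P := MonoidHom.mk' (fun w => ⟨D.pr (𝓕.diff p q (𝓕'.ι i w)), D.pr_mem _⟩)
    (fun w w' => by
      ext
      simp only [Subgroup.coe_mul, map_mul]
      exact hmul _ ⟨w, w.2, rfl⟩ _)
  have hf : ∀ w, 𝓕.ι j (f w) = D.quot p q (𝓕'.ι i w) := fun w => rfl
  refine ⟨MulEquiv.ofBijective f ⟨?_, ?_⟩⟩
  · rw [injective_iff_map_eq_one]
    intro w hw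
    obtain ⟨x, hx, hwx⟩ := (hQm (𝓕'.ι i w)).1 ⟨w, w.2, rfl⟩
    have h1 := hf w
    rw [hw, OneMemClass.coe_one, map_one, hwx] at h1
    have h2 := hpq hx D.X.one_mem (by
      rw [Function.comp_apply, Function.comp_apply, ← h1, M.proj_one, D.quot_one])
    rw [h2, M.proj_one] at hwx
    exact Subtype.ext ((map_eq_one_iff _ (𝓕'.ι_injective i)).1 hwx)
  · intro u
    obtain ⟨n, hn⟩ := exists_iterate_leftInverse
      (f := D.quot p q ∘ M.proj {i}) (fun x => D.quot_mem _ _ _) hpq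
    have hu : 𝓕.ι j u ∈ D.X := ⟨u, u.2, rfl⟩
    have hmaps : Set.MapsTo (D.quot p q ∘ M.proj {i}) D.X D.X := fun x _ => D.quot_mem _ _ _
    have h1 := hn _ hu
    rw [← Function.iterate_succ_apply, Function.iterate_succ_apply'] at h1
    obtain ⟨w, hw, hwx⟩ := (hQm _).2 ⟨_, hmaps.iterate n hu, rfl⟩
    refine ⟨⟨w, hw⟩, Subtype.ext (𝓕.ι_injective j ?_)⟩
    rw [hf]
    simp only
    rw [hwx]
    exact h1

end Frame.Mixed

/-! ### The exchange argument -/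

namespace Frame.Mixed

variable {K : Type*} [Group K] {A : Subgroup K} {I G I' G' : Type*} [Group G] [Group G']
  [Nontrivial I] [Nontrivial I'] {𝓕 : Frame A I G} {𝓕' : Frame A I' G'} {C : I → Subgroup G}
  {S' : I' → Subgroup G'} (M : 𝓕.Mixed 𝓕' C S') {o j : I} (D : 𝓕.Factor C o j)

include M

/-- The part of the factor `i` that is not seen from `P` is complementary to the image
of `P`. -/
theorem exists_complement [Finite K] {i : I'} {Q : Subgroup G'} (hQS : Q ≤ S' i)
    (hQm : ∀ z, z ∈ Q.map (𝓕'.ι i) ↔ ∃ x ∈ D.X, z = M.proj {i} x)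
    (hinj : Set.InjOn (D.quot j o ∘ M.proj {i}) D.X) :
    ∃ R : Subgroup G', 𝓕'.Inv R ∧ (∀ w, w ∈ R ↔ w ∈ S' i ∧ D.quot j o (𝓕'.ι i w) = 1) ∧
      Disjoint R Q ∧ R ⊔ Q = S' i := by
  obtain ⟨Z, hZ, hZpre⟩ := (D.isBlockMap_quot j o).preimage A le_rfl
  have hmemZ : ∀ x y, (D.quot j o x)⁻¹ * D.quot j o y = 1 ↔ x⁻¹ * y ∈ Z := fun x y => by
    rw [← hZpre]
    refine ⟨fun h => h ▸ A.one_mem, fun h => ?_⟩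
    have : (D.quot j o x)⁻¹ * D.quot j o y ∈ D.X ⊓ A :=
      ⟨D.X.mul_mem (D.X.inv_mem (D.quot_mem _ _ _)) (D.quot_mem _ _ _), h⟩
    rwa [D.X_inf] at this
  have hmemZ1 : ∀ x, D.quot j o x = 1 ↔ x ∈ Z := fun x => by
    simpa [D.quot_one] using hmemZ 1 x
  have hR : ∀ w, w ∈ S' i ⊓ Z.comap (𝓕'.ι i) ↔ w ∈ S' i ∧ D.quot j o (𝓕'.ι i w) = 1 :=
    fun w => by rw [hmemZ1]; rfl
  have hRinv : 𝓕'.Inv (S' i ⊓ Z.comap (𝓕'.ι i)) := by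
    rintro a w ⟨hw, hwZ⟩
    refine ⟨M.inv_right i a w hw, ?_⟩
    show 𝓕'.ι i _ ∈ Z
    rw [← 𝓕'.ι_conj]
    exact Z.mul_mem (Z.mul_mem (hZ a.2) hwZ) (Z.inv_mem (hZ a.2))
  refine ⟨_, hRinv, hR, ?_, le_antisymm (sup_le inf_le_left hQS) fun w hw => ?_⟩
  · rw [Subgroup.disjoint_def]
    intro w hwR hwQ
    obtain ⟨x, hx, hwx⟩ := (hQm (𝓕'.ι i w)).1 ⟨w, hwQ, rfl⟩
    have h1 := hinj hx D.X.one_mem (by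
      rw [Function.comp_apply, Function.comp_apply, ← hwx, ((hR w).1 hwR).2, M.proj_one,
        D.quot_one])
    rw [h1, M.proj_one] at hwx
    exact (map_eq_one_iff _ (𝓕'.ι_injective i)).1 hwx
  · obtain ⟨n, hn⟩ := exists_iterate_leftInverse
      (f := D.quot j o ∘ M.proj {i}) (fun x => D.quot_mem _ _ _) hinj
    have hmaps : Set.MapsTo (D.quot j o ∘ M.proj {i}) D.X D.X := fun x _ => D.quot_mem _ _ _
    have h1 := hn _ (D.quot_mem j o (𝓕'.ι i w))
    rw [← Function.iterate_succ_apply, Function.iterate_succ_apply'] at h1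
    obtain ⟨q, hq, hqx⟩ := (hQm _).2 ⟨_, hmaps.iterate n (D.quot_mem j o (𝓕'.ι i w)), rfl⟩
    rw [Function.comp_apply, ← hqx] at h1
    have h2 : q⁻¹ * w ∈ S' i ⊓ Z.comap (𝓕'.ι i) := by
      refine ⟨(S' i).mul_mem ((S' i).inv_mem (hQS hq)) hw, ?_⟩
      show 𝓕'.ι i (q⁻¹ * w) ∈ Z
      rw [map_mul, map_inv, ← hmemZ, h1, inv_mul_cancel]
    have h3 := Subgroup.mul_mem_sup hq h2
    rw [mul_inv_cancel_left] at h3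
    rwa [sup_comm]

open scoped Classical in
/-- The exchange step: in a mixed decomposition the image of `P` may be replaced by `P`. -/
theorem exchange {i : I'} {Q R : Subgroup G'}
    (hQm : ∀ z, z ∈ Q.map (𝓕'.ι i) ↔ ∃ x ∈ D.X, z = M.proj {i} x)
    (hinj : Set.InjOn (D.quot j o ∘ M.proj {i}) D.X) (hRinv : 𝓕'.Inv R)
    (hR : ∀ w, w ∈ R ↔ w ∈ S' i ∧ D.quot j o (𝓕'.ι i w) = 1) (hRQ : R ⊔ Q = S' i)
    (hQ : 𝓕'.Inv Q) :
    𝓕.Mixed 𝓕' (Function.update C j (C j ⊔ D.P)) (Function.update S' i R) := by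
  have hupd : ∀ {v : I' → G'}, (∀ k, v k ∈ S' k) → v i ∈ R →
      ∀ k, v k ∈ Function.update S' i R k := by
    intro v hv hi k
    by_cases hk : k = i
    · subst hk; simpa using hi
    · simpa [hk] using hv k
  have hupd' : ∀ {v : I' → G'}, (∀ k, v k ∈ Function.update S' i R k) →
      v i ∈ R ∧ ∀ k, v k ∈ S' k := by
    intro v hv
    have hvi : v i ∈ R := by simpa using hv i
    refine ⟨hvi, fun k => ?_⟩
    by_cases hk : k = i
    · subst hk; exact ((hR _).1 hvi).1
    · simpa [hk] using hv k
  refine ⟨fun l => ?_, fun k => ?_, fun x => ?_, fun v c hv hc hvc => ?_⟩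
  · by_cases hl : l = j
    · subst hl; simpa using (M.inv_left l).sup D.inv
    · simpa [hl] using M.inv_left l
  · by_cases hk : k = i
    · subst hk; simpa using hRinv
    · simpa [hk] using M.inv_right k
  · obtain ⟨v, hv, c, hc, a, ha, rfl⟩ := M.exists_eq x
    have := hQ.normal
    obtain ⟨r, hr, q, hq, hrq⟩ := Subgroup.mem_sup_of_normal_right.1 (hRQ ▸ hv i)
    obtain ⟨x₀, hx₀, hqx⟩ := (hQm _).1 ⟨q, hq, rfl⟩
    obtain ⟨w, hw, d, hd, b, hb, hx₀e⟩ := M.exists_eq x₀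
    have hwi : w i = q := by
      apply 𝓕'.ι_injective i
      rw [hqx, M.proj_singleton, hx₀e, M.coord_eq hw hd hb]
    obtain ⟨u, hu, rfl⟩ := hx₀
    -- `w'` collects the components of `ι j u` outside the factor `i`.
    have hw' : ∀ k, Function.update w i 1 k ∈ S' k := fun k => by
      by_cases hk : k = i
      · subst hk; simp [(S' k).one_mem]
      · simpa [hk] using hw k
    obtain ⟨τ, hτ, hτS⟩ := 𝓕'.exists_conj (𝓕.ι j u * b⁻¹ * (𝓕.hom d)⁻¹)
    have h1 := hτ (Function.update w i 1)⁻¹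
    have h2 := 𝓕.conj ⟨b⁻¹, A.inv_mem hb⟩ (d⁻¹ * c)
    simp only at h2
    have h3 : 𝓕'.ι i q = 𝓕.ι j u * b⁻¹ * (𝓕.hom d)⁻¹ * (𝓕'.hom (Function.update w i 1))⁻¹ := by
      rw [hx₀e, mul_inv_cancel_right, mul_inv_cancel_right, ← map_inv, ← map_mul, ι_apply]
      congr 1
      ext k
      by_cases hk : k = i
      · subst hk; simp [hwi]
      · simp [hk]
    have h4 : 𝓕'.hom v = 𝓕'.hom (Function.update v i r) * 𝓕'.ι i q := by
      rw [ι_apply, ← map_mul]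
      congr 1
      ext k
      by_cases hk : k = i
      · subst hk; simp [hrq]
      · simp [hk]
    refine ⟨Function.update v i r * fun k => τ k ((Function.update w i 1)⁻¹ k), ?_,
      Pi.mulSingle j u * fun l => 𝓕.act ⟨b⁻¹, A.inv_mem hb⟩ ((d⁻¹ * c) l), ?_, b⁻¹ * a,
      A.mul_mem (A.inv_mem hb) ha, ?_⟩
    · refine hupd (fun k => (S' k).mul_mem ?_ ?_) (by simpa using hr)
      · by_cases hk : k = i
        · subst hk; simpa using ((hR r).1 hr).1
        · simpa [hk] using hv k
      · exact hτS _ (M.inv_right k) (M.inv_right k).normal k _ ((S' k).inv_mem (hw' k))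
    · intro l
      have hl1 : 𝓕.act ⟨b⁻¹, A.inv_mem hb⟩ ((d⁻¹ * c) l) ∈ C l :=
        M.inv_left l _ _ ((C l).mul_mem ((C l).inv_mem (hd l)) (hc l))
      by_cases hl : l = j
      · subst hl
        simp only [Pi.mul_apply, Pi.mulSingle_eq_same, Function.update_self]
        exact mul_mem (Subgroup.mem_sup_right hu) (Subgroup.mem_sup_left hl1)
      · simpa [hl] using hl1
    · rw [map_mul, map_mul, ← h1, ← h2, ← ι_apply, h4, h3, map_inv, map_mul, map_inv]
      group
  · obtain ⟨hvi, hv'⟩ := hupd' hv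
    have := D.inv.normal
    have hcj : c j ∈ D.P ⊔ C j := by simpa [sup_comm] using hc j
    have := (M.inv_left j).normal
    obtain ⟨p, hp, c₀, hc₀, hpc⟩ := Subgroup.mem_sup_of_normal_right.1 hcj
    have hc' : ∀ l, Function.update c j c₀ l ∈ C l := fun l => by
      by_cases hl : l = j
      · subst hl; simpa using hc₀
      · simpa [hl] using hc l
    have h1 : 𝓕.hom c = 𝓕.ι j p * 𝓕.hom (Function.update c j c₀) := by
      rw [ι_apply, ← map_mul]
      congr 1
      ext k
      by_cases hk : k = j
      · subst hk; simp [hpc]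
      · simp [hk]
    set a := 𝓕'.hom v * 𝓕.hom c with ha
    have h2 := 𝓕.conj ⟨a, hvc⟩ (Function.update c j c₀)⁻¹
    simp only at h2
    have h3 : 𝓕.ι j p = 𝓕'.hom v⁻¹ *
        𝓕.hom (fun l => 𝓕.act ⟨a, hvc⟩ ((Function.update c j c₀)⁻¹ l)) * a := by
      rw [← h2, map_inv, map_inv, ha, h1]
      group
    have hX : 𝓕.ι j p ∈ D.X := ⟨p, hp, rfl⟩
    have h4 : M.proj {i} (𝓕.ι j p) = 𝓕'.ι i (v i)⁻¹ := by
      rw [M.proj_singleton, h3, M.coord_eq (v := v⁻¹)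
        (c := fun l => 𝓕.act ⟨a, hvc⟩ ((Function.update c j c₀)⁻¹ l))
        (fun k => (S' k).inv_mem (hv' k))
        (fun l => M.inv_left l _ _ ((C l).inv_mem (hc' l))) hvc]
      rfl
    have h5 : 𝓕.ι j p = 1 := hinj hX D.X.one_mem (by
      rw [Function.comp_apply, Function.comp_apply, h4, ((hR _).1 (R.inv_mem hvi)).2, M.proj_one,
        D.quot_one])
    have hp1 : p = 1 := (map_eq_one_iff _ (𝓕.ι_injective j)).1 h5
    refine M.eq_one v c hv' (fun l => ?_) hvc
    by_cases hl : l = j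
    · subst hl; rw [← hpc, hp1, one_mul]; exact hc₀
    · simpa [hl] using hc l

end Frame.Mixed

/-! ### Frames over isomorphic groups -/

theorem card_hom_of_eq_bot {F G : Type*} [Group F] [Group G] {S : Subgroup G} (h : S = ⊥) :
    Nat.card (F →* S) = 1 := by
  subst h
  have : Subsingleton (F →* (⊥ : Subgroup G)) :=
    ⟨fun f g => MonoidHom.ext fun x => Subsingleton.elim _ _⟩
  exact Nat.card_unique

theorem prod_card_hom_ite {I F H : Type*} [Fintype I] [DecidableEq I] [Group F] [Group H] (o : I) :
    ∏ l : I, Nat.card (F →* ((if l = o then ⊥ else ⊤ : Subgroup H))) =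
      Nat.card (F →* H) ^ (Fintype.card I - 1) := by
  rw [← Finset.mul_prod_erase _ _ (Finset.mem_univ o), card_hom_of_eq_bot (by simp), one_mul,
    Finset.prod_congr rfl (g := fun _ => Nat.card (F →* H)), Finset.prod_const,
    Finset.card_erase_of_mem (Finset.mem_univ _), Finset.card_univ]
  intro l hl
  rw [if_neg (Finset.ne_of_mem_erase hl)]
  exact card_hom_congr Subgroup.topEquiv

namespace Frame

variable {K : Type*} [Group K] {A : Subgroup K} {I G I' G' : Type*} [Group G] [Group G']
  [Nontrivial I] [Nontrivial I']

/-- Every nontrivial invariant subgroup has an indecomposable direct factor, namely a minimal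
one. -/
theorem exists_indecomposable [Finite G] (𝓕 : Frame A I G) (l : I) {S : Subgroup G}
    (hS : 𝓕.Inv S) (hne : S ≠ ⊥) : ∃ P R, 𝓕.Inv P ∧ 𝓕.Inv R ∧ P ≠ ⊥ ∧ Disjoint P R ∧ P ⊔ R = S ∧
      IsIndecomposable A (P.map (𝓕.ι l)) := by
  obtain ⟨P, ⟨hP, hPne, R, hR, hd, hs⟩, hmin⟩ := Set.Finite.exists_minimal
    (s := {P | 𝓕.Inv P ∧ P ≠ ⊥ ∧ ∃ R, 𝓕.Inv R ∧ Disjoint P R ∧ P ⊔ R = S}) (Set.toFinite _)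
    ⟨S, hS, hne, ⊥, 𝓕.inv_bot, disjoint_bot_right, sup_bot_eq _⟩
  refine ⟨P, R, hP, hR, hPne, hd, hs, ?_⟩
  intro B C hB hC hBA hCA hBC hsup
  obtain ⟨B, hBi, rfl⟩ := 𝓕.exists_inv_map l (hB.trans (Subgroup.map_le_range _ _)) hBA
  obtain ⟨C, hCi, rfl⟩ := 𝓕.exists_inv_map l (hC.trans (Subgroup.map_le_range _ _)) hCA
  have hinj := 𝓕.ι_injective l
  rw [Subgroup.map_le_map_iff_of_injective hinj] at hB hC
  have hdBC : ∀ x ∈ B, x ∈ C → x = 1 := by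
    intro x hxB hxC
    have : 𝓕.ι l x ∈ B.map (𝓕.ι l) ⊓ C.map (𝓕.ι l) := ⟨⟨x, hxB, rfl⟩, ⟨x, hxC, rfl⟩⟩
    rw [hBC, Subgroup.mem_bot] at this
    exact (map_eq_one_iff _ hinj).1 this
  have hP' : P ≤ B ⊔ C := by
    intro x hx
    obtain ⟨_, ⟨b, hb, rfl⟩, _, ⟨c, hc, rfl⟩, h⟩ := hsup _ ⟨x, hx, rfl⟩
    rw [← map_mul] at h
    rw [hinj h]
    exact Subgroup.mul_mem_sup hb hc
  by_cases hB1 : B = ⊥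
  · left; rw [hB1, Subgroup.map_bot]
  right
  have hle : P ≤ B := by
    refine hmin ⟨hBi, hB1, C ⊔ R, hCi.sup hR, ?_, ?_⟩ hB
    · rw [Subgroup.disjoint_def]
      intro x hxB hx
      have := hR.normal
      obtain ⟨c, hc, r, hr, rfl⟩ := Subgroup.mem_sup_of_normal_right.1 hx
      have hr1 : r = 1 := Subgroup.disjoint_def.1 hd
        ((P.mul_mem_cancel_left (hC hc)).1 (hB hxB)) hr
      rw [hr1, mul_one] at hxB ⊢
      exact hdBC c hxB hc
    · rw [← sup_assoc, le_antisymm (sup_le hB hC) hP', hs]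
  have hC1 : C = ⊥ := by
    rw [eq_bot_iff]
    intro x hx
    exact hdBC x (hle (hC hx)) hx
  rw [hC1, Subgroup.map_bot]

variable {𝓕 : Frame A I G} {𝓕' : Frame A I' G'}

/-- The parts of a mixed decomposition in the copies of `G'` are as large as the complements of its
parts in the copies of `G`: this is the Krull–Schmidt theorem for the two frames, with
isomorphism types recorded by counting homomorphisms. -/
theorem Mixed.prod_card_hom_eq [Fintype I] [Fintype I'] [Finite K] [Finite G] (F : Type*) [Group F]
    (hI : 3 ≤ Fintype.card I) (o : I) (n : ℕ) (S C : I → Subgroup G) (S' : I' → Subgroup G')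
    (hn : ∑ l, Nat.card (S l) = n) (hS : ∀ l, 𝓕.Inv (S l)) (hSo : S o = ⊥) (hCo : C o = ⊥)
    (hSC : ∀ l, l ≠ o → IsCompl (S l) (C l)) (M : 𝓕.Mixed 𝓕' C S') :
    ∏ l, Nat.card (F →* S l) = ∏ i, Nat.card (F →* S' i) := by
  classical
  induction n using Nat.strong_induction_on generalizing S C S' with
  | _ n ih =>
    by_cases hall : ∀ l, S l = ⊥
    · -- The parts `C l` exhaust everything.
      have hS' : ∀ i, S' i = ⊥ := by
        intro i
        rw [eq_bot_iff]
        intro w hw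
        obtain ⟨a, ha, v, hv, h⟩ := 𝓕.exists_mul_mem_hom o (𝓕'.ι i w)⁻¹
        have h1 : 𝓕'.hom (Pi.mulSingle i w) * 𝓕.hom v = a := by
          rw [← h, ← ι_apply, mul_inv_cancel_left]
        have h2 := (M.eq_one (Pi.mulSingle i w) v (fun k => ?_) (fun l => ?_) (h1 ▸ ha)).1
        · simpa using congrFun h2 i
        · by_cases hk : k = i
          · subst hk; simpa using hw
          · simp [hk, (S' k).one_mem]
        · by_cases hl : l = o
          · subst hl; rw [hv]; exact (C l).one_mem
          · have := (hSC l hl).sup_eq_top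
            rw [hall l, bot_sup_eq] at this
            rw [this]; trivial
      rw [Finset.prod_congr rfl fun l _ => card_hom_of_eq_bot (F := F) (hall l),
        Finset.prod_congr rfl fun i _ => card_hom_of_eq_bot (F := F) (hS' i)]
      simp
    · push Not at hall
      obtain ⟨j, hj⟩ := hall
      have hjo : j ≠ o := by rintro rfl; exact hj hSo
      obtain ⟨P, R, hP, hR, hPne, hd, hs, hind⟩ := 𝓕.exists_indecomposable j (hS j) hj
      have hPn := hP.normal
      have hRn := hR.normal
      have hCn := (M.inv_left j).normal
      have hcompl := hSC j hjo
      have hPS : P ≤ S j := hs ▸ le_sup_left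
      have hRS : R ≤ S j := hs ▸ le_sup_right
      -- `S j = P × R` and `G = S j × C j`, so `P` and `R × C j` are complementary, and so on.
      have hPc : IsCompl P (R ⊔ C j) := by
        refine ⟨?_, codisjoint_iff.2 (by rw [← sup_assoc, hs, hcompl.sup_eq_top])⟩
        rw [Subgroup.disjoint_def]
        intro x hx hxr
        obtain ⟨r, hr, c, hc, rfl⟩ := Subgroup.mem_sup_of_normal_right.1 hxr
        have hc1 : c = 1 := Subgroup.disjoint_def.1 hcompl.disjoint
          (((S j).mul_mem_cancel_left (hRS hr)).1 (hPS hx)) hc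
        rw [hc1, mul_one] at hx ⊢
        exact Subgroup.disjoint_def.1 hd hx hr
      have hRc : IsCompl R (C j ⊔ P) := by
        refine ⟨?_, codisjoint_iff.2 (by
          rw [sup_comm (C j), ← sup_assoc, sup_comm R, hs, hcompl.sup_eq_top])⟩
        rw [Subgroup.disjoint_def]
        intro x hx hxr
        obtain ⟨c, hc, p, hp, rfl⟩ := Subgroup.mem_sup_of_normal_right.1 hxr
        have hc1 : c = 1 := Subgroup.disjoint_def.1 hcompl.disjoint
          (((S j).mul_mem_cancel_right (hPS hp)).1 (hRS hx)) hc
        rw [hc1, one_mul] at hx ⊢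
        exact Subgroup.disjoint_def.1 hd hp hx
      obtain ⟨pr, hpr1, hpr2, hpr3⟩ := exists_proj_of_isCompl P (R ⊔ C j) hPc
      have hPcinv : 𝓕.Inv (R ⊔ C j) := hR.sup (M.inv_left j)
      let D : 𝓕.Factor C o j :=
        { P := P, pr := pr, inv := hP, ne_bot := hPne, ne := hjo, pr_mem := hpr1, pr_eq := hpr2
          pr_left := fun c hc => hpr3 c (Subgroup.mem_sup_right hc), base := hCo, indec := hind
          pr_act := fun a g => by
            obtain ⟨p, hp, c, hc, rfl⟩ := Subgroup.mem_sup_of_normal_right.1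
              (hPc.sup_eq_top ▸ Subgroup.mem_top g)
            rw [map_mul, map_mul, map_mul, map_mul, hpr2 p hp, hpr3 c hc, hpr2 _ (hP a p hp),
              hpr3 _ (hPcinv a c hc), map_one] }
      obtain ⟨i, hinj⟩ := M.exists_injOn D
      obtain ⟨Q, hQ, hQS, hQm⟩ := M.exists_image D i
      obtain ⟨e⟩ := M.nonempty_mulEquiv D hI hQ hQm hinj
      obtain ⟨R', hR', hR'm, hRQd, hRQ⟩ := M.exists_complement D hQS hQm hinj
      have M' := M.exchange D hQm hinj hR' hR'm hRQ hQ
      have hlt : Nat.card R < Nat.card (S j) := by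
        refine lt_of_le_of_ne (Subgroup.card_le_of_le hRS) fun h => hPne ?_
        have : R = S j := Subgroup.eq_of_le_of_card_ge hRS h.ge
        rw [eq_bot_iff]
        intro x hx
        exact Subgroup.disjoint_def.1 hd hx (this ▸ hPS hx)
      have hsum : ∑ l, Nat.card (Function.update S j R l) < n := by
        rw [← hn]
        refine Finset.sum_lt_sum (fun l _ => ?_) ⟨j, Finset.mem_univ _, by simpa using hlt⟩
        by_cases hl : l = j
        · subst hl; simpa using hlt.le
        · simp [hl]
      have hrec := ih _ hsum (Function.update S j R) _ _ rfl
        (fun l => by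
          by_cases hl : l = j
          · subst hl; simpa using hR
          · simpa [hl] using hS l)
        (by simpa [hjo.symm] using hSo) (by simpa [hjo.symm] using hCo)
        (fun l hl => by
          by_cases hl' : l = j
          · subst hl'; simpa using hRc
          · simpa [hl'] using hSC l hl) M'
      -- Both products change by the factor `Nat.card (F →* P)`.
      have e1 : ∏ l, Nat.card (F →* S l) =
          Nat.card (F →* P) * ∏ l, Nat.card (F →* (Function.update S j R l : Subgroup G)) := by
        rw [← Finset.mul_prod_erase _ _ (Finset.mem_univ j),
          ← Finset.mul_prod_erase Finset.univ _ (Finset.mem_univ j), ← mul_assoc]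
        congr 1
        · rw [Function.update_self, ← card_hom_sup P R hd, hs]
        · refine Finset.prod_congr rfl fun l hl => ?_
          rw [Function.update_of_ne (Finset.ne_of_mem_erase hl)]
      have hQn := hQ.normal
      have hR'n := hR'.normal
      have e2 : ∏ i, Nat.card (F →* S' i) =
          Nat.card (F →* P) * ∏ k, Nat.card (F →* (Function.update S' i R' k : Subgroup G')) := by
        rw [← Finset.mul_prod_erase _ _ (Finset.mem_univ i),
          ← Finset.mul_prod_erase Finset.univ _ (Finset.mem_univ i), ← mul_assoc]
        congr 1
        · have e3 : Nat.card (F →* Q) = Nat.card (F →* P) := card_hom_congr e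
          rw [Function.update_self, ← hRQ, card_hom_sup R' Q hRQd, e3, mul_comm]
        · refine Finset.prod_congr rfl fun l hl => ?_
          rw [Function.update_of_ne (Finset.ne_of_mem_erase hl)]
      rw [e1, e2, hrec]

/-- Finite groups that have frames with at least three copies in the same group, over the same
point stabilizer, are isomorphic. -/
theorem nonempty_mulEquiv [Fintype I] [Finite K] [Finite G] [Finite G'] (𝓕 : Frame A I G)
    (𝓕' : Frame A I G') (hI : 3 ≤ Fintype.card I) (hcard : Nat.card G = Nat.card G') :
    Nonempty (G ≃* G') := by
  classical
  refine nonempty_mulEquiv_of_card_hom_eq hcard fun F _ _ => ?_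
  obtain ⟨o⟩ := (inferInstance : Nonempty I)
  have M : 𝓕.Mixed 𝓕' (fun _ => ⊥) (fun i => if i = o then ⊥ else ⊤) := by
    refine ⟨fun l => 𝓕.inv_bot, fun i => ?_, fun x => ?_, fun v c hv hc h => ?_⟩
    · split_ifs
      · exact 𝓕'.inv_bot
      · exact 𝓕'.inv_top
    · obtain ⟨a, ha, v, hv, h⟩ := 𝓕'.exists_mul_mem_hom o x
      refine ⟨v, fun i => ?_, 1, fun l => Subgroup.one_mem _, a⁻¹, A.inv_mem ha, ?_⟩
      · split_ifs with hi
        · subst hi; exact hv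
        · trivial
      · rw [map_one, ← h]; group
    · have hc1 : c = 1 := funext fun l => hc l
      rw [hc1, map_one, mul_one, 𝓕'.hom_mem_iff] at h
      have hvo : v o = 1 := by simpa using hv o
      exact ⟨funext fun i => (h i o).trans hvo, hc1⟩
  have h := M.prod_card_hom_eq F hI o _ (fun l => if l = o then ⊥ else ⊤) _ _ rfl
    (fun l => by
      split_ifs
      · exact 𝓕.inv_bot
      · exact 𝓕.inv_top)
    (by simp) rfl (fun l hl => by simpa [hl] using isCompl_top_bot)
  rw [prod_card_hom_ite, prod_card_hom_ite] at h
  exact Nat.pow_left_injective (by omega : Fintype.card I - 1 ≠ 0) h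

end Frame

/-! ### The frame of `Hol_m(G)` -/

theorem holPow_apply {G : Type*} [Group G] {m : ℕ} {π : Equiv.Perm (Fin m → G)}
    (hπ : π ∈ holPow m G) : ∃ (g : Fin m → G) (σ : MulAut G), ∀ x i, π x i = σ (x i) * g i := by
  obtain ⟨g, σ, rfl⟩ := hπ
  exact ⟨g, σ, fun x i => rfl⟩

/-- `Hol_m(G)` contains `m + 1` commuting copies of `G`: the right multiplications in the `m`
coordinates, and the left multiplications by diagonal elements. -/
def holHom (m : ℕ) (G : Type*) [Group G] : (Option (Fin m) → G) →* holPow m G where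
  toFun v := ⟨Equiv.mulRight (fun i => v none * (v (some i))⁻¹) *
    autComponentwise m (MulAut.conj (v none)), _, _, rfl⟩
  map_one' := by ext; simp [autComponentwise]
  map_mul' v w := by ext; simp [autComponentwise, mul_assoc]

theorem holHom_apply {m : ℕ} {G : Type*} [Group G] (v : Option (Fin m) → G) (x : Fin m → G)
    (i : Fin m) : (holHom m G v : Equiv.Perm (Fin m → G)) x i =
      v none * x i * (v (some i))⁻¹ := by
  simp [holHom, autComponentwise, mul_assoc]

theorem exists_eq_of_holPow_fix {G : Type*} [Group G] {m : ℕ} {π : Equiv.Perm (Fin m → G)}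
    (hπ : π ∈ holPow m G) (h1 : π 1 = 1) : ∃ σ : G →* G, ∀ x i, π x i = σ (x i) := by
  obtain ⟨g, σ, h⟩ := holPow_apply hπ
  have hg : ∀ i, g i = 1 := fun i => by
    have := h 1 i
    rw [h1] at this
    simpa using this.symm
  exact ⟨σ.toMonoidHom, fun x i => by simp [h, hg]⟩

/-- The frame of a group isomorphic to `Hol_m(G)`, over the stabilizer of `1`. -/
noncomputable def holFrame {K : Type*} [Group K] {m : ℕ} {G : Type*} [Group G]
    (e : K ≃* holPow m G) (A : Subgroup K)
    (hA : ∀ k, k ∈ A ↔ (e k : Equiv.Perm (Fin m → G)) 1 = 1) : Frame A (Option (Fin m)) G where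
  hom := e.symm.toMonoidHom.comp (holHom m G)
  act a := (exists_eq_of_holPow_fix (e a).2 ((hA a).1 a.2)).choose
  conj a v := by
    have hσ := (exists_eq_of_holPow_fix (e a).2 ((hA a).1 a.2)).choose_spec
    set σ := (exists_eq_of_holPow_fix (e a).2 ((hA a).1 a.2)).choose
    rw [mul_inv_eq_iff_eq_mul]
    apply e.injective
    rw [map_mul, map_mul]
    simp only [MonoidHom.comp_apply, MulEquiv.toMonoidHom_eq_coe, MonoidHom.coe_coe,
      MulEquiv.apply_symm_apply]
    ext x i
    simp [hσ, holHom_apply]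
  hom_mem_iff v := by
    rw [hA]
    simp only [MonoidHom.comp_apply, MulEquiv.toMonoidHom_eq_coe, MonoidHom.coe_coe,
      MulEquiv.apply_symm_apply, funext_iff, holHom_apply, Pi.one_apply, mul_one]
    constructor
    · intro h
      have h' : ∀ l, v l = v none := by
        rintro (_ | i)
        · rfl
        · exact (mul_inv_eq_one.1 (h i)).symm
      exact fun l k => (h' l).trans (h' k).symm
    · exact fun h i => mul_inv_eq_one.2 (h _ _)
  exists_eq x := by
    obtain ⟨g, σ, h⟩ := holPow_apply (e x).2
    have hσ : autComponentwise m σ ∈ holPow m G := ⟨1, σ, by ext; simp [autComponentwise]⟩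
    refine ⟨fun l => l.elim 1 fun i => (g i)⁻¹, e.symm ⟨_, hσ⟩, ?_, ?_⟩
    · rw [hA]
      ext i
      simp [autComponentwise]
    · apply e.injective
      ext y i
      simp [h, holHom_apply, autComponentwise]

/-- A permutation isomorphism may be assumed to respect the base points. -/
theorem PermIsomorphic.exists_map_one {m : ℕ} {G G' : Type*} [Group G] [Group G']
    (h : PermIsomorphic (holPow m G) (holPow m G')) :
    ∃ (f : (Fin m → G) ≃ (Fin m → G')) (ψ : holPow m G ≃* holPow m G'), f 1 = 1 ∧
      ∀ (k : holPow m G) x, f ((k : Equiv.Perm (Fin m → G)) x) =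
        (ψ k : Equiv.Perm (Fin m → G')) (f x) := by
  obtain ⟨f, ψ, hf⟩ := h
  let τ : holPow m G' := ⟨Equiv.mulRight (f 1)⁻¹, (f 1)⁻¹, 1, by ext; simp [autComponentwise]⟩
  refine ⟨f.trans (τ : Equiv.Perm (Fin m → G')), ψ.trans (MulAut.conj τ), ?_, fun k x => ?_⟩
  · simp [τ]
  · simp [hf]

theorem nonempty_mulEquiv_of_permIsomorphic {m : ℕ} (hm : 2 ≤ m) {G G' : Type*} [Group G]
    [Finite G] [Group G'] [Finite G'] (h : PermIsomorphic (holPow m G) (holPow m G')) :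
    Nonempty (G ≃* G') := by
  obtain ⟨f, ψ, hf1, hf⟩ := h.exists_map_one
  have hcard : Nat.card G = Nat.card G' := by
    have := Nat.card_congr f
    simp only [Nat.card_fun, Nat.card_fin] at this
    exact Nat.pow_left_injective (by omega : m ≠ 0) this
  let A : Subgroup (holPow m G) := MulAction.stabilizer (holPow m G) (1 : Fin m → G)
  have hA : ∀ k, k ∈ A ↔ (k : Equiv.Perm (Fin m → G)) 1 = 1 := fun k => Iff.rfl
  have : NeZero m := ⟨by omega⟩
  refine (holFrame (MulEquiv.refl _) A hA).nonempty_mulEquiv (holFrame ψ A fun k => ?_)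
    (by simp; omega) hcard
  rw [hA, ← f.injective.eq_iff, hf, hf1]

/-! ### S-rings and automorphisms -/

namespace SchurRing

variable {Γ Γ' : Type*} [Group Γ] [Finite Γ] [Group Γ'] [Finite Γ']

theorem setSum_mem_iff (A : SchurRing Γ) (Y : Set Γ) : setSum Y ∈ A.toSubmodule ↔
    ∀ X ∈ A.basicSets, ∀ x ∈ X, ∀ y ∈ X, x ∈ Y → y ∈ Y := by
  rw [mem_toSubmodule_iff]
  constructor
  · intro h X hX x hx y hy hxY
    have := h X hX x hx y hy
    rw [coeff_setSum, coeff_setSum, if_pos hxY] at this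
    by_contra hyY
    simp [hyY] at this
  · intro h X hX x hx y hy
    have : x ∈ Y ↔ y ∈ Y := ⟨h X hX x hx y hy, h X hX y hy x hx⟩
    rw [coeff_setSum, coeff_setSum]
    by_cases hy' : y ∈ Y
    · rw [if_pos hy', if_pos (this.2 hy')]
    · rw [if_neg hy', if_neg (mt this.1 hy')]

theorem setSum_mem_of_mem (A : SchurRing Γ) {X : Set Γ} (hX : X ∈ A.basicSets) :
    setSum X ∈ A.toSubmodule :=
  Submodule.subset_span ⟨X, hX, rfl⟩

theorem le_iff (A B : SchurRing Γ) :
    A ≤ B ↔ ∀ X ∈ A.basicSets, setSum X ∈ B.toSubmodule := by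
  refine ⟨fun h X hX => h (A.setSum_mem_of_mem hX), fun h => ?_⟩
  refine Submodule.span_le.2 ?_
  rintro _ ⟨X, hX, rfl⟩
  exact h X hX

/-- The image of an S-ring under a group isomorphism. -/
def map (e : Γ ≃* Γ') (A : SchurRing Γ) : SchurRing Γ' :=
  have hpart : Setoid.IsPartition {Y : Set Γ' | e ⁻¹' Y ∈ A.basicSets} := by
    refine ⟨fun h => A.isPartition.1 (by simpa using h), fun a => ?_⟩
    obtain ⟨X, ⟨hX, ha⟩, hu⟩ := A.isPartition.2 (e.symm a)
    refine ⟨e '' X, ⟨?_, e.symm a, ha, by simp⟩, ?_⟩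
    · show e ⁻¹' (e '' X) ∈ A.basicSets
      rwa [Set.preimage_image_eq _ e.injective]
    · rintro Y ⟨hY, haY⟩
      rw [← hu _ ⟨hY, by simpa using haY⟩, Set.image_preimage_eq _ e.surjective]
  { basicSets := {Y | e ⁻¹' Y ∈ A.basicSets}
    isPartition := hpart
    one_mem := by
      have : e ⁻¹' {1} = {1} := by ext; simp
      rw [Set.mem_ofPred_eq, this]
      exact A.one_mem
    inv_mem := fun X hX => by
      have : e ⁻¹' (Inv.inv ⁻¹' X) = Inv.inv ⁻¹' (e ⁻¹' X) := by ext; simp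
      rw [Set.mem_ofPred_eq, this]
      exact A.inv_mem _ hX
    mul_mem := fun X hX Y hY => by
      have hcoeff : ∀ z, (setSum X * setSum Y).coeff (e z) =
          (setSum (e ⁻¹' X) * setSum (e ⁻¹' Y)).coeff z := fun z => by
        rw [coeff_setSum_mul, coeff_setSum_mul]
        congr 1
        refine (Nat.card_congr (e.toEquiv.subtypeEquiv fun x => ?_)).symm
        simp
      rw [mem_span_setSum_iff hpart]
      intro Z hZ x hx y hy
      obtain ⟨x, rfl⟩ := e.surjective x
      obtain ⟨y, rfl⟩ := e.surjective y
      rw [hcoeff, hcoeff]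
      exact (A.mem_toSubmodule_iff _).1 (A.mul_mem _ hX _ hY) _ hZ x hx y hy }

theorem mem_map_basicSets (e : Γ ≃* Γ') (A : SchurRing Γ) (Y : Set Γ') :
    Y ∈ (A.map e).basicSets ↔ e ⁻¹' Y ∈ A.basicSets := Iff.rfl

theorem setSum_mem_map_iff (e : Γ ≃* Γ') (A : SchurRing Γ) (Y : Set Γ') :
    setSum Y ∈ (A.map e).toSubmodule ↔ setSum (e ⁻¹' Y) ∈ A.toSubmodule := by
  rw [setSum_mem_iff, setSum_mem_iff]
  constructor
  · intro h X hX x hx y hy hxY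
    have hX' : e '' X ∈ (A.map e).basicSets := by
      rwa [mem_map_basicSets, Set.preimage_image_eq _ e.injective]
    exact h _ hX' (e x) ⟨x, hx, rfl⟩ (e y) ⟨y, hy, rfl⟩ hxY
  · intro h X hX x hx y hy hxY
    simpa using h _ hX (e.symm x) (by simpa using hx) (e.symm y) (by simpa using hy)
      (by simpa using hxY)

variable {G G' : Type*} [Group G] [Finite G] [Group G'] [Finite G']

theorem tensorPower_le_diagonalExtension (m : ℕ) :
    (trivialSRing G).tensorPower m ≤ diagonalExtension m G :=
  (isLeast_extension _ _).1.1

theorem setSum_diagonal_mem (m : ℕ) :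
    setSum {x : Fin m → G | ∃ g : G, x = fun _ => g} ∈ (diagonalExtension m G).toSubmodule :=
  (isLeast_extension _ _).1.2

theorem diagonalExtension_le {m : ℕ} {B : SchurRing (Fin m → G)}
    (h1 : (trivialSRing G).tensorPower m ≤ B)
    (h2 : setSum {x : Fin m → G | ∃ g : G, x = fun _ => g} ∈ B.toSubmodule) :
    diagonalExtension m G ≤ B :=
  (isLeast_extension _ _).2 ⟨h1, h2⟩

theorem diagonalExtension_le_map (m : ℕ) (e : G ≃* G') : diagonalExtension m G' ≤
    (diagonalExtension m G).map (MulEquiv.piCongrRight fun _ => e) := by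
  refine diagonalExtension_le ?_ ?_
  · rw [le_iff]
    rintro _ ⟨Y, hY, rfl⟩
    rw [setSum_mem_map_iff]
    refine tensorPower_le_diagonalExtension m (setSum_mem_of_mem _
      ⟨fun i => e ⁻¹' Y i, fun i => ⟨?_, ?_⟩, ?_⟩)
    · exact (hY i).1.preimage e.surjective
    · refine (hY i).2.imp (fun h => ?_) fun h => ?_
      · show e ⁻¹' Y i = {1}
        rw [h]; ext; simp
      · show e ⁻¹' Y i = {1}ᶜ
        rw [h]; ext; simp
    · ext x; simp
  · rw [setSum_mem_map_iff]
    convert setSum_diagonal_mem (G := G) m using 2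
    ext x
    constructor
    · rintro ⟨g, hg⟩
      exact ⟨e.symm g, funext fun i => e.injective (by simpa using congrFun hg i)⟩
    · rintro ⟨g, rfl⟩
      exact ⟨e g, rfl⟩

theorem map_diagonalExtension (m : ℕ) (e : G ≃* G') :
    (diagonalExtension m G).map (MulEquiv.piCongrRight fun _ => e) = diagonalExtension m G' := by
  refine toSubmodule_injective (le_antisymm ?_ (diagonalExtension_le_map m e))
  refine (le_iff _ _).2 fun Z hZ => ?_
  have h := (le_iff _ _).1 (diagonalExtension_le_map m e.symm) _ hZ
  rw [setSum_mem_map_iff] at h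
  convert h using 2
  ext x
  have : (MulEquiv.piCongrRight fun _ => e) ((MulEquiv.piCongrRight fun _ => e.symm) x) = x := by
    ext i; simp
  simp [this]

theorem combIsomorphic_of_mulEquiv (m : ℕ) (e : G ≃* G') :
    CombIsomorphic (diagonalExtension m G) (diagonalExtension m G') := by
  let ε : (Fin m → G) ≃* (Fin m → G') := MulEquiv.piCongrRight fun _ => e
  refine ⟨ε.toEquiv, fun X hX => ⟨ε '' X, ?_, fun x y => ?_⟩⟩
  · rw [← map_diagonalExtension m e, mem_map_basicSets]
    exact (Set.preimage_image_eq X ε.injective).symm ▸ hX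
  · show x * y⁻¹ ∈ X ↔ ε x * (ε y)⁻¹ ∈ ε '' X
    rw [← map_inv, ← map_mul, ε.injective.mem_set_image]

/-- The S-ring over `G^m` whose basic sets are the orbits of `Aut(G)`. -/
def orbitSRing (m : ℕ) (G : Type*) [Group G] [Finite G] : SchurRing (Fin m → G) :=
  let r : Setoid (Fin m → G) :=
    { r := fun x y => ∃ σ : MulAut G, ∀ i, σ (x i) = y i
      iseqv :=
        { refl := fun x => ⟨1, fun i => rfl⟩
          symm := fun ⟨σ, h⟩ => ⟨σ⁻¹, fun i => by simp [← h]⟩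
          trans := fun ⟨σ, h⟩ ⟨τ, h'⟩ => ⟨τ * σ, fun i => by simp [h, h']⟩ } }
  have hcl : ∀ X ∈ r.classes, ∀ (σ : MulAut G) (x : Fin m → G),
      (fun i => σ (x i)) ∈ X ↔ x ∈ X := by
    rintro _ ⟨z, rfl⟩ σ x
    have hx : r x fun i => σ (x i) := ⟨σ, fun i => rfl⟩
    exact ⟨fun h => r.trans' hx h, fun h => r.trans' (r.symm' hx) h⟩
  { basicSets := r.classes
    isPartition := Setoid.isPartition_classes r
    one_mem := by
      refine ⟨1, ?_⟩
      ext x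
      constructor
      · rintro rfl
        exact r.refl' 1
      · rintro ⟨σ, h⟩
        refine funext fun i => ?_
        simpa using h i
    inv_mem := by
      rintro _ ⟨z, rfl⟩
      refine ⟨z⁻¹, ?_⟩
      ext x
      constructor
      · rintro ⟨σ, h⟩
        exact ⟨σ, fun i => by simpa using congrArg (·⁻¹) (h i)⟩
      · rintro ⟨σ, h⟩
        exact ⟨σ, fun i => by simp [h i]⟩
    mul_mem := by
      intro X hX Y hY
      rw [mem_span_setSum_iff (Setoid.isPartition_classes r)]
      rintro _ ⟨z, rfl⟩ x hx y hy
      obtain ⟨σ, h⟩ : r x y := r.trans' hx (r.symm' hy)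
      obtain rfl : (fun i => σ (x i)) = y := funext h
      rw [coeff_setSum_mul, coeff_setSum_mul]
      congr 1
      refine Nat.card_congr ((autComponentwise m σ).subtypeEquiv fun u => ?_)
      refine and_congr (hcl X hX σ u).symm ?_
      rw [← hcl Y hY σ]
      have : (fun i => σ ((u⁻¹ * x) i)) = (autComponentwise m σ u)⁻¹ * fun i => σ (x i) := by
        ext i; simp [autComponentwise]
      rw [this] }

theorem mem_basicSets_orbitSRing {m : ℕ} {X : Set (Fin m → G)}
    (hX : X ∈ (orbitSRing m G).basicSets) {x y : Fin m → G} (hx : x ∈ X) (hy : y ∈ X) :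
    ∃ σ : MulAut G, ∀ i, σ (x i) = y i := by
  obtain ⟨z, rfl⟩ := hX
  obtain ⟨σ, h⟩ := hx
  obtain ⟨τ, h'⟩ := hy
  exact ⟨τ⁻¹ * σ, fun i => by simp [h, ← h']⟩

theorem setSum_mem_orbitSRing_iff {m : ℕ} (Y : Set (Fin m → G)) :
    setSum Y ∈ (orbitSRing m G).toSubmodule ↔
      ∀ (σ : MulAut G), ∀ x ∈ Y, (fun i => σ (x i)) ∈ Y := by
  rw [setSum_mem_iff]
  constructor
  · intro h σ x hx
    obtain ⟨X, ⟨hX, hxX⟩, -⟩ := (orbitSRing m G).isPartition.2 x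
    refine h X hX x hxX _ ?_ hx
    obtain ⟨z, rfl⟩ := hX
    obtain ⟨τ, h'⟩ := hxX
    exact ⟨τ * σ⁻¹, fun i => by simp [h']⟩
  · intro h X hX x hx y hy hxY
    obtain ⟨σ, h'⟩ := mem_basicSets_orbitSRing hX hx hy
    obtain rfl : (fun i => σ (x i)) = y := funext h'
    exact h σ x hxY

theorem diagonalExtension_le_orbitSRing (m : ℕ) : diagonalExtension m G ≤ orbitSRing m G := by
  refine diagonalExtension_le ?_ ?_
  · rw [le_iff]
    rintro _ ⟨Y, hY, rfl⟩
    rw [setSum_mem_orbitSRing_iff]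
    intro σ x hx i hi
    rcases (hY i).2 with h | h
    · have := hx i hi
      rw [h] at this ⊢
      simpa using this
    · have := hx i hi
      rw [h] at this ⊢
      simpa using this
  · rw [setSum_mem_orbitSRing_iff]
    rintro σ _ ⟨g, rfl⟩
    exact ⟨σ g, rfl⟩

/-- A permutation preserves an S-ring if it is an automorphism of the Cayley graphs of all basic
sets. -/
def Preserves (A : SchurRing Γ) (π : Equiv.Perm Γ) : Prop :=
  ∀ X ∈ A.basicSets, ∀ x y, x * y⁻¹ ∈ X ↔ π x * (π y)⁻¹ ∈ X

theorem Preserves.mem_iff {A : SchurRing Γ} {π : Equiv.Perm Γ} (h : A.Preserves π) {Y : Set Γ}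
    (hY : setSum Y ∈ A.toSubmodule) (x y : Γ) : x * y⁻¹ ∈ Y ↔ π x * (π y)⁻¹ ∈ Y := by
  obtain ⟨X, ⟨hX, hx⟩, -⟩ := A.isPartition.2 (x * y⁻¹)
  have hx' := (h X hX x y).1 hx
  have := (A.setSum_mem_iff Y).1 hY X hX
  exact ⟨this _ hx _ hx', this _ hx' _ hx⟩

theorem preserves_of_mem_holPow {m : ℕ} {π : Equiv.Perm (Fin m → G)} (hπ : π ∈ holPow m G) :
    (diagonalExtension m G).Preserves π := by
  intro X hX x y
  obtain ⟨g, σ, h⟩ := holPow_apply hπ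
  have hinv := (setSum_mem_orbitSRing_iff X).1 (diagonalExtension_le_orbitSRing m
    (setSum_mem_of_mem _ hX))
  have e : π x * (π y)⁻¹ = fun i => σ ((x * y⁻¹) i) := by
    ext i; simp [h]
  rw [e]
  refine ⟨hinv σ _, fun h' => ?_⟩
  have := hinv σ⁻¹ _ h'
  simpa only [MulAut.inv_apply_self] using this

theorem setSum_coordinate_mem (m : ℕ) (i : Fin m) :
    setSum {x : Fin m → G | x i = 1} ∈ (diagonalExtension m G).toSubmodule := by
  refine tensorPower_le_diagonalExtension m ((setSum_mem_iff _ _).2 ?_)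
  rintro _ ⟨Y, hY, rfl⟩ x hx y hy h1
  have hxi := hx i trivial
  have hyi := hy i trivial
  rw [Set.mem_ofPred_eq] at h1 ⊢
  rw [h1] at hxi
  rcases (hY i).2 with h | h
  · rw [h] at hyi; exact hyi
  · rw [h] at hxi; exact absurd rfl hxi

/-- The coordinates and the diagonal already force a permutation that preserves the S-ring and
fixes `1` to be a componentwise acting automorphism of `G`. -/
theorem mem_holPow_of_preserves {m : ℕ} (hm : 2 ≤ m) {π : Equiv.Perm (Fin m → G)}
    (hπ : (diagonalExtension m G).Preserves π) : π ∈ holPow m G := by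
  classical
  let i₀ : Fin m := ⟨0, by omega⟩
  let i₁ : Fin m := ⟨1, by omega⟩
  have hi : i₁ ≠ i₀ := by simp [i₀, i₁]
  let τ : (Fin m → G) → (Fin m → G) := fun x => π x * (π 1)⁻¹
  have hτ : ∀ x y, τ x * (τ y)⁻¹ = π x * (π y)⁻¹ := fun x y => by simp [τ]
  have hτ1 : τ 1 = 1 := by simp [τ]
  have hcoord : ∀ x y i, x i = y i ↔ τ x i = τ y i := fun x y i => by
    have h := hπ.mem_iff (setSum_coordinate_mem m i) x y
    rw [← hτ] at h
    simpa [mul_inv_eq_one] using h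
  have hdiag : ∀ x y, (∃ g : G, x * y⁻¹ = fun _ => g) ↔ ∃ g : G, τ x * (τ y)⁻¹ = fun _ => g :=
    fun x y => by
      rw [hτ]
      exact hπ.mem_iff (setSum_diagonal_mem m) x y
  let s : G → G := fun g => τ (fun _ => g) i₀
  have hs : ∀ x i, τ x i = s (x i) := fun x i => by
    rw [(hcoord x (fun _ => x i) i).1 rfl]
    obtain ⟨g, hg⟩ := (hdiag (fun _ => x i) 1).1 ⟨x i, by simp⟩
    rw [hτ1, inv_one, mul_one] at hg
    simp only [s, hg]
  have hs1 : s 1 = 1 := by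
    have := hs 1 i₀
    rw [hτ1] at this
    exact this.symm
  have hmul : ∀ g h, s (g * h) = s g * s h := fun g h => by
    obtain ⟨k, hk⟩ := (hdiag (Function.update (fun _ => g) i₀ (g * h))
      (Function.update 1 i₀ h)).1 ⟨g, by
        ext i
        by_cases hi : i = i₀
        · subst hi; simp
        · simp [hi]⟩
    have h0 := congrFun hk i₀
    have h1 := congrFun hk i₁
    simp only [Pi.mul_apply, Pi.inv_apply, hs, Function.update_self,
      Function.update_of_ne hi, Pi.one_apply, hs1, inv_one, mul_one] at h0 h1
    rw [h1, ← h0, inv_mul_cancel_right]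
  have hinj : Function.Injective s := fun g h hgh => by
    refine (hcoord (fun _ => g) (fun _ => h) i₀).2 ?_
    rw [hs, hs]
    exact hgh
  let σ : MulAut G := MulEquiv.ofBijective (MonoidHom.mk' s hmul)
    (Finite.injective_iff_bijective.1 hinj)
  refine ⟨π 1, σ, ?_⟩
  ext x i
  have h := hs x i
  simp only [τ, Pi.mul_apply, Pi.inv_apply] at h
  have h' : π x i = s (x i) * π 1 i := by rw [← h, inv_mul_cancel_right]
  rw [h']
  rfl

theorem permIsomorphic_of_combIsomorphic {m : ℕ} (hm : 2 ≤ m)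
    (h : CombIsomorphic (diagonalExtension m G) (diagonalExtension m G')) :
    PermIsomorphic (holPow m G) (holPow m G') := by
  obtain ⟨f, hf⟩ := h
  -- The correspondence of basic sets induced by `f` is onto.
  have hsurj : ∀ X' ∈ (diagonalExtension m G').basicSets,
      ∃ X ∈ (diagonalExtension m G).basicSets,
        ∀ x y, x * y⁻¹ ∈ X ↔ f x * (f y)⁻¹ ∈ X' := by
    intro X' hX'
    obtain ⟨z, hz⟩ := Setoid.nonempty_of_mem_partition (diagonalExtension m G').isPartition hX'
    obtain ⟨X, ⟨hX, hx⟩, -⟩ :=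
      (diagonalExtension m G).isPartition.2 (f.symm z * (f.symm 1)⁻¹)
    obtain ⟨X'', hX'', h⟩ := hf X hX
    have hz' : z ∈ X'' := by simpa [cayleyGraph] using (h _ _).1 hx
    have : X'' = X' :=
      ((diagonalExtension m G').isPartition.2 z).unique ⟨hX'', hz'⟩ ⟨hX', hz⟩
    exact ⟨X, hX, this ▸ h⟩
  have hmap : (holPow m G).map (f.permCongrHom : _ ≃* _).toMonoidHom = holPow m G' := by
    ext π
    constructor
    · rintro ⟨ρ, hρ, rfl⟩
      refine mem_holPow_of_preserves hm fun X' hX' x y => ?_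
      obtain ⟨X, hX, h⟩ := hsurj X' hX'
      have h1 := preserves_of_mem_holPow hρ X hX (f.symm x) (f.symm y)
      rw [h, h] at h1
      simpa using h1
    · intro hπ
      refine ⟨f.symm.permCongrHom π, mem_holPow_of_preserves hm fun X hX x y => ?_, ?_⟩
      · obtain ⟨X', hX', h⟩ := hf X hX
        have h1 := preserves_of_mem_holPow hπ X' hX' (f x) (f y)
        have h2 := h x y
        have h3 := h (f.symm (π (f x))) (f.symm (π (f y)))
        simp only [cayleyGraph, Equiv.apply_symm_apply] at h2 h3
        simpa [h2, h3] using h1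
      · ext x; simp
  refine ⟨f, (f.permCongrHom.subgroupMap (holPow m G)).trans (MulEquiv.subgroupCongr hmap),
    fun k x => ?_⟩
  show f ((k : Equiv.Perm _) x) = f.permCongrHom (k : Equiv.Perm _) (f x)
  simp

end SchurRing

theorem theorem1p1 {G : Type*} {G' : Type*} [Group G] [Finite G] [Group G'] [Finite G']
    (m : ℕ) (hm : 3 ≤ m) :
    List.TFAE
      [Nonempty (G ≃* G'),
       SchurRing.CombIsomorphic (SchurRing.diagonalExtension m G)
         (SchurRing.diagonalExtension m G'),
       PermIsomorphic (holPow m G) (holPow m G')] := by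
  tfae_have 1 → 2 := fun ⟨e⟩ => SchurRing.combIsomorphic_of_mulEquiv m e
  tfae_have 2 → 3 := SchurRing.permIsomorphic_of_combIsomorphic (by omega)
  tfae_have 3 → 1 := nonempty_mulEquiv_of_permIsomorphic (by omega)
  tfae_finish
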